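/- For real numbers $m,l$ let $F=1+m(x^2+y^2)$ and let $M^3(m,l)$ be the Bianchi–Cartan–Vranceanu (BCV) space $$\{(x,y,z)\in\mathbb R^3: F>0\},\qquad h=\frac{dx^2+dy^2}{F^2}+\Big[dz+\frac l2\,\frac{y\,dx-x\,dy}{F}\Big]^2 ,$$ so that $(x,y,z)\mapsto(x,y)$ is a Riemannian submersion onto the surface $\big(\{F>0\}\subset\mathbb R^2,\ h_1=(dx^2+dy^2)/F^2\big)$ of Gauss curvature $4m$. For $l=0$, $M^3(m,l)$ is the Riemannian product $S^2(4m)\times\mathbb R$ (with the sphere in its stereographic chart) if $m>0$, $H^2(4m)\times\mathbb R$ if $m<0$, and Euclidean $\mathbb R^3$ if $m=0$. For $l\ne0$ it is (a chart of) $S^3$ if $4m=l^2$, $SU(2)$ if $m>0$, $Nil$ if $m=0$, and $\widetilde{SL}(2,\mathbb R)$ if $m<0$. Let $I\subseteq\mathbb R$ be an open interval and $\gamma=(x(s),y(s)):I\to(\{F>0\},h_1)$ a smooth curve parametrized by arc length. The Hopf cylinder over $\gamma$ is the union of the fibres over $\gamma$, parametrized by $\varphi(s,z)=(x(s),y(s),z)$,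 $(s,z)\in I\times\mathbb R$. Let $\Sigma\subseteq I\times\mathbb R$ be a nonempty connected open set (for instance all of $I\times\mathbb R$) and $f:\Sigma\to(0,\infty)$ a smooth function. The conformal immersion $\varphi:(\Sigma,\bar g=f^{-1}\varphi^*h)\to M^3(m,l)$, with conformal factor $f^{1/2}$, is called proper biharmonic if its tension field $\tau(\varphi)=\mathrm{Trace}_{\bar g}\nabla d\varphi$ does not vanish identically on $\Sigma$ while its bitension field $$\tau_2(\varphi)=\mathrm{Trace}_{\bar g}\big(\nabla^\varphi\nabla^\varphi-\nabla^\varphi_{\nabla^{\Sigma}}\big)\tau(\varphi)-\mathrm{Trace}_{\bar g}R^{M}(d\varphi,\tau(\varphi))d\varphi$$ vanishes identically on $\Sigma$, where $R^M(X,Y)Z=[\nabla_X,\nabla_Y]Z-\nabla_{[X,Y]}Z$. (i) If there is a proper biharmonic conformal immersion $\varphi:(\Sigma,f^{-1}\varphi^*h)\to M^3(m,l)$ of this kind with nonconstant conformal factor $f^{1/2}$, then $M^3(m,l)$ is $S^2(c)\times\mathbb R$ for some $c>0$, or $H^2(c)\times\mathbb R$ for some $c<0$, or $\mathbb R^3$.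 (ii) If $M^3(m,l)$ is $S^3$, $Nil$, $\widetilde{SL}(2,\mathbb R)$ or $SU(2)$, then there is no proper biharmonic conformal immersion $\varphi:(\Sigma,f^{-1}\varphi^*h)\to M^3(m,l)$ of this kind with nonconstant conformal factor. -/

import Mathlib

open scoped ContDiff Matrix

noncomputable section

namespace BCV

/-! ## Riemannian geometry in a chart

A Riemannian metric on an open set of `ℝⁿ` is given by its component matrix `g p i j`. -/

/-- The partial derivative `∂F/∂pᵢ`. -/
def partialD {n : ℕ} {E : Type*} [NormedAddCommGroup E] [NormedSpace ℝ E]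
    (i : Fin n) (F : (Fin n → ℝ) → E) (p : Fin n → ℝ) : E :=
  fderiv ℝ F p (Pi.single i 1)

/-- The Christoffel symbol `Γᵏᵢⱼ` of the Levi-Civita connection of `g`. -/
def christoffel {n : ℕ} (g : (Fin n → ℝ) → Matrix (Fin n) (Fin n) ℝ) (k i j : Fin n)
    (p : Fin n → ℝ) : ℝ :=
  (1 / 2) * ∑ r, (g p)⁻¹ k r *
    (partialD i (fun q => g q j r) p + partialD j (fun q => g q i r) p
      - partialD r (fun q => g q i j) p)

/-- The curvature component `Rᵃ_bcd`, where `R(∂_c, ∂_d) ∂_b = Rᵃ_bcd ∂_a` and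
`R(X,Y)Z = ∇_X ∇_Y Z - ∇_Y ∇_X Z - ∇_[X,Y] Z`. -/
def curvature {n : ℕ} (h : (Fin n → ℝ) → Matrix (Fin n) (Fin n) ℝ) (a b c d : Fin n)
    (p : Fin n → ℝ) : ℝ :=
  partialD c (christoffel h a d b) p - partialD d (christoffel h a c b) p
    + ∑ e, (christoffel h a c e p * christoffel h e d b p
      - christoffel h a d e p * christoffel h e c b p)

/-- The vector `R(X,Y)Z` at the point `p`. -/
def curvatureOp {n : ℕ} (h : (Fin n → ℝ) → Matrix (Fin n) (Fin n) ℝ) (p : Fin n → ℝ)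
    (X Y Z : Fin n → ℝ) : Fin n → ℝ :=
  fun a => ∑ b, ∑ c, ∑ d, curvature h a b c d p * X c * Y d * Z b

/-- The pull-back connection: `∇^φ_{∂ᵢ} W` for a vector field `W` along `φ`. -/
def pullbackD {k n : ℕ} (h : (Fin n → ℝ) → Matrix (Fin n) (Fin n) ℝ)
    (φ : (Fin k → ℝ) → (Fin n → ℝ)) (i : Fin k) (W : (Fin k → ℝ) → (Fin n → ℝ))
    (p : Fin k → ℝ) : Fin n → ℝ :=
  fun a => partialD i W p a
    + ∑ b, ∑ c, christoffel h a b c (φ p) * partialD i φ p b * W p c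

/-- The tension field `τ(φ) = Trace_g ∇dφ` of `φ : (M, g) → (N, h)`. -/
def tension {k n : ℕ} (g : (Fin k → ℝ) → Matrix (Fin k) (Fin k) ℝ)
    (h : (Fin n → ℝ) → Matrix (Fin n) (Fin n) ℝ) (φ : (Fin k → ℝ) → (Fin n → ℝ))
    (p : Fin k → ℝ) : Fin n → ℝ :=
  ∑ i, ∑ j, (g p)⁻¹ i j •
    (pullbackD h φ i (partialD j φ) p - ∑ r, christoffel g r i j p • partialD r φ p)

/-- The bitension field
`τ₂(φ) = Trace_g (∇^φ ∇^φ - ∇^φ_{∇^M}) τ(φ) - Trace_g R^N(dφ, τ(φ)) dφ`. -/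
def bitension {k n : ℕ} (g : (Fin k → ℝ) → Matrix (Fin k) (Fin k) ℝ)
    (h : (Fin n → ℝ) → Matrix (Fin n) (Fin n) ℝ) (φ : (Fin k → ℝ) → (Fin n → ℝ))
    (p : Fin k → ℝ) : Fin n → ℝ :=
  ∑ i, ∑ j, (g p)⁻¹ i j •
    (pullbackD h φ i (pullbackD h φ j (tension g h φ)) p
      - ∑ r, christoffel g r i j p • pullbackD h φ r (tension g h φ) p
      - curvatureOp h (φ p) (partialD i φ p) (tension g h φ p) (partialD j φ p))

/-- `φ : (U, g) → (N, h)` is proper biharmonic: biharmonic and not harmonic. -/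
def IsProperBiharmonicOn {k n : ℕ} (g : (Fin k → ℝ) → Matrix (Fin k) (Fin k) ℝ)
    (h : (Fin n → ℝ) → Matrix (Fin n) (Fin n) ℝ) (φ : (Fin k → ℝ) → (Fin n → ℝ))
    (U : Set (Fin k → ℝ)) : Prop :=
  (∀ p ∈ U, bitension g h φ p = 0) ∧ ¬ ∀ p ∈ U, tension g h φ p = 0

/-- The components of `φ*h`. -/
def pullbackMetric {k n : ℕ} (h : (Fin n → ℝ) → Matrix (Fin n) (Fin n) ℝ)
    (φ : (Fin k → ℝ) → (Fin n → ℝ)) (p : Fin k → ℝ) : Matrix (Fin k) (Fin k) ℝ :=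
  Matrix.of fun i j => partialD i φ p ⬝ᵥ (h (φ p) *ᵥ partialD j φ p)

/-! ## Bianchi–Cartan–Vranceanu spaces -/

/-- `F = 1 + m (x² + y²)`. -/
def factor (m x y : ℝ) : ℝ := 1 + m * (x ^ 2 + y ^ 2)

/-- The underlying open set of `M³(m, l)`: all of `ℝ³` if `m ≥ 0`, and the solid cylinder
`1 + m (x² + y²) > 0` if `m < 0`. -/
def space (m : ℝ) : Set (Fin 3 → ℝ) := {p | 0 < factor m (p 0) (p 1)}

/-- The contact form `dz + (l/2) (y dx - x dy) / F`, as a row of components. -/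
def form (m l : ℝ) (p : Fin 3 → ℝ) : Fin 3 → ℝ :=
  ![l / 2 * p 1 / factor m (p 0) (p 1), -(l / 2 * p 0 / factor m (p 0) (p 1)), 1]

/-- The metric `(dx² + dy²) / F² + (dz + (l/2) (y dx - x dy) / F)²` of `M³(m, l)`. -/
def metric (m l : ℝ) (p : Fin 3 → ℝ) : Matrix (Fin 3) (Fin 3) ℝ :=
  Matrix.diagonal ![1 / factor m (p 0) (p 1) ^ 2, 1 / factor m (p 0) (p 1) ^ 2, 0]
    + Matrix.vecMulVec (form m l p) (form m l p)

/-- The metric `(dx² + dy²) / F²`, of Gauss curvature `4m`, of the base surface of the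
Riemannian submersion `(x, y, z) ↦ (x, y)`. -/
def baseMetric (m : ℝ) (q : Fin 2 → ℝ) : Matrix (Fin 2) (Fin 2) ℝ :=
  Matrix.diagonal ![1 / factor m (q 0) (q 1) ^ 2, 1 / factor m (q 0) (q 1) ^ 2]

/-! ## The spaces among them -/

/-- The Riemannian product of the surface of constant curvature `c`, in the conformal chart
`(dx² + dy²) / (1 + (c/4) (x² + y²))²`, with the line. -/
def productMetric (c : ℝ) (p : Fin 3 → ℝ) : Matrix (Fin 3) (Fin 3) ℝ :=
  Matrix.diagonal ![1 / (1 + c / 4 * (p 0 ^ 2 + p 1 ^ 2)) ^ 2,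
    1 / (1 + c / 4 * (p 0 ^ 2 + p 1 ^ 2)) ^ 2, 1]

/-- `M³(m, l)` is the product `S²(c) × ℝ` for some `c > 0` (the sphere being in its
stereographic chart). -/
def IsSphereTimesLine (m l : ℝ) : Prop :=
  ∃ c : ℝ, 0 < c ∧ space m = {p | 0 < 1 + c / 4 * (p 0 ^ 2 + p 1 ^ 2)} ∧
    ∀ p ∈ space m, metric m l p = productMetric c p

/-- `M³(m, l)` is the product `H²(c) × ℝ` for some `c < 0` (the hyperbolic plane being in the
Poincaré disc chart). -/
def IsHyperbolicPlaneTimesLine (m l : ℝ) : Prop :=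
  ∃ c : ℝ, c < 0 ∧ space m = {p | 0 < 1 + c / 4 * (p 0 ^ 2 + p 1 ^ 2)} ∧
    ∀ p ∈ space m, metric m l p = productMetric c p

/-- `M³(m, l)` is `ℝ³` with the flat metric `dx² + dy² + dz²`. -/
def IsEuclidean (m l : ℝ) : Prop :=
  space m = Set.univ ∧ ∀ p, metric m l p = 1

/-- `M³(m, l)` is `S³` (of constant curvature `m = l²/4 > 0`). -/
def IsSphere (m l : ℝ) : Prop := l ≠ 0 ∧ 4 * m = l ^ 2

/-- `M³(m, l)` is the Heisenberg group `Nil`. -/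
def IsNil (m l : ℝ) : Prop := l ≠ 0 ∧ m = 0

/-- `M³(m, l)` is the universal cover of `SL(2, ℝ)`. -/
def IsSLTilde (m l : ℝ) : Prop := l ≠ 0 ∧ m < 0

/-- `M³(m, l)` is `SU(2)`. -/
def IsSU (m l : ℝ) : Prop := l ≠ 0 ∧ 0 < m

/-! ## Hopf cylinders -/

/-- `γ` is a smooth curve in the base surface, parametrized by arc length on the open
interval `I`. -/
structure IsUnitSpeedCurve (m : ℝ) (I : Set ℝ) (γ : ℝ → Fin 2 → ℝ) : Prop where
  isOpen : IsOpen I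
  ordConnected : I.OrdConnected
  smooth : ContDiffOn ℝ ∞ γ I
  mem_base : ∀ s ∈ I, 0 < factor m (γ s 0) (γ s 1)
  unit_speed : ∀ s ∈ I, deriv γ s ⬝ᵥ (baseMetric m (γ s) *ᵥ deriv γ s) = 1

/-- The Hopf cylinder over `γ`, i.e. the union of the fibres over `γ`, parametrized by
`φ(s, z) = (x(s), y(s), z)`. -/
def hopfCylinder (γ : ℝ → Fin 2 → ℝ) (p : Fin 2 → ℝ) : Fin 3 → ℝ :=
  ![γ (p 0) 0, γ (p 0) 1, p 1]

/-- The conformal immersion `φ : (U, f⁻¹ φ*h) → M³(m, l)` of (the part given by the nonempty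
connected open set `U ⊆ I × ℝ` of) the Hopf cylinder over `γ` is proper biharmonic, and its
conformal factor `f^(1/2)` is not constant. -/
structure IsProperBiharmonicHopf (m l : ℝ) (I : Set ℝ) (γ : ℝ → Fin 2 → ℝ)
    (U : Set (Fin 2 → ℝ)) (f : (Fin 2 → ℝ) → ℝ) : Prop where
  curve : IsUnitSpeedCurve m I γ
  isOpen : IsOpen U
  isConnected : IsConnected U
  subset : U ⊆ {p | p 0 ∈ I}
  smooth : ContDiffOn ℝ ∞ f U
  pos : ∀ p ∈ U, 0 < f p
  nonconstant : ¬ ∃ c : ℝ, ∀ p ∈ U, √(f p) = c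
  properBiharmonic : IsProperBiharmonicOn
    (fun p => (f p)⁻¹ • pullbackMetric (metric m l) (hopfCylinder γ) p)
    (metric m l) (hopfCylinder γ) U

end BCV

end

/-!
Let `θ = contact m l γ γ'`, so that `E = ∂ₛ - θ(s) ∂_z` is the horizontal lift of the unit tangent
of `γ` and commutes with `∂_z`, and let `κ` be the geodesic curvature of `γ`. The tension field of
the conformal immersion is `u N`, where `N` is the horizontal lift of the unit normal of `γ` and
`u = f κ`. In the orthonormal frame of `E`, `N` and `∂_z`, biharmonicity becomes
`l u_z = κ' u + 2 κ E u`, `E E u + u_zz = u (κ² + l² - 4m)` and `l E u = 0`.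

If `l ≠ 0`, then `E u = 0` and `l u_z = κ' u`. Where `u ≠ 0`, differentiating the latter along `E`
gives `κ'' = 0`, and differentiating it along `z` and inserting the normal equation gives
`κ'² = l² (κ² + l² - 4m)`. One more derivative along `E` yields `l² κ κ' = 0`, so `κ' = 0` and
`du = 0`. Hence `u²` is constant on the connected domain, and nonzero as `φ` is not harmonic.
Therefore `κ' = 0` everywhere and `f = u / κ` is constant.
-/

noncomputable section

namespace BCV

open Filter Topology

/-! ### Levi-Civita connections in a chart -/

section Chart

variable {n : ℕ} {g g' : (Fin n → ℝ) → Matrix (Fin n) (Fin n) ℝ} {p X Y Z : Fin n → ℝ}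

theorem fderiv_eq_sum_partialD {E : Type*} [NormedAddCommGroup E] [NormedSpace ℝ E]
    (F : (Fin n → ℝ) → E) (p X : Fin n → ℝ) : fderiv ℝ F p X = ∑ i, X i • partialD i F p := by
  rw [← ContinuousLinearMap.coe_coe, LinearMap.pi_apply_eq_sum_univ]
  refine Finset.sum_congr rfl fun i _ => ?_
  rw [partialD, ContinuousLinearMap.coe_coe]
  congr
  ext j
  simp [Pi.single_apply, eq_comm]

theorem partialD_congr {E : Type*} [NormedAddCommGroup E] [NormedSpace ℝ E]
    {F G : (Fin n → ℝ) → E} (h : F =ᶠ[𝓝 p] G) (i : Fin n) : partialD i F p = partialD i G p := by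
  rw [partialD, partialD, h.fderiv_eq]

theorem differentiableAt_of_contDiffOn {E F : Type*} [NormedAddCommGroup E] [NormedSpace ℝ E]
    [NormedAddCommGroup F] [NormedSpace ℝ F] {w : E → F} {V : Set E} {x : E} (hV : IsOpen V)
    (hw : ContDiffOn ℝ ∞ w V) (hx : x ∈ V) : DifferentiableAt ℝ w x :=
  (hw.contDiffAt (hV.mem_nhds hx)).differentiableAt (by simp)

theorem contDiffOn_partialD {E : Type*} [NormedAddCommGroup E] [NormedSpace ℝ E]
    {F : (Fin n → ℝ) → E} {U : Set (Fin n → ℝ)} (hU : IsOpen U) (hF : ContDiffOn ℝ ∞ F U)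
    (i : Fin n) : ContDiffOn ℝ ∞ (partialD i F) U :=
  (hF.fderiv_of_isOpen hU (by simp)).clm_apply contDiffOn_const

/-- The vector `Γ(X, Y)` with components `Γᵏᵢⱼ Xⁱ Yʲ`, i.e. `∇_X Y` at `p` for the constant
extensions of `X` and `Y`. -/
def christoffelOp (g : (Fin n → ℝ) → Matrix (Fin n) (Fin n) ℝ) (p X Y : Fin n → ℝ) : Fin n → ℝ :=
  fun k => ∑ i, ∑ j, christoffel g k i j p * X i * Y j

theorem christoffelOp_add_left (X₁ X₂ : Fin n → ℝ) :
    christoffelOp g p (X₁ + X₂) Y = christoffelOp g p X₁ Y + christoffelOp g p X₂ Y := by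
  ext k
  simp only [christoffelOp, Pi.add_apply, ← Finset.sum_add_distrib]
  exact Finset.sum_congr rfl fun i _ => Finset.sum_congr rfl fun j _ => by ring

theorem christoffelOp_smul_left (a : ℝ) :
    christoffelOp g p (a • X) Y = a • christoffelOp g p X Y := by
  ext k
  simp only [christoffelOp, Pi.smul_apply, smul_eq_mul, Finset.mul_sum]
  exact Finset.sum_congr rfl fun i _ => Finset.sum_congr rfl fun j _ => by ring

theorem christoffelOp_add_right (Y₁ Y₂ : Fin n → ℝ) :
    christoffelOp g p X (Y₁ + Y₂) = christoffelOp g p X Y₁ + christoffelOp g p X Y₂ := by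
  ext k
  simp only [christoffelOp, Pi.add_apply, mul_add, ← Finset.sum_add_distrib]

theorem christoffelOp_smul_right (a : ℝ) :
    christoffelOp g p X (a • Y) = a • christoffelOp g p X Y := by
  ext k
  simp only [christoffelOp, Pi.smul_apply, smul_eq_mul, Finset.mul_sum]
  exact Finset.sum_congr rfl fun i _ => Finset.sum_congr rfl fun j _ => by ring

theorem christoffelOp_single (i j k : Fin n) :
    christoffelOp g p (Pi.single i 1) (Pi.single j 1) k = christoffel g k i j p := by
  simp [christoffelOp, Pi.single_apply]

theorem eq_of_dotProduct_mulVec_eq {A : Matrix (Fin n) (Fin n) ℝ} (hA : IsUnit A.det)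
    (h : ∀ Z, Z ⬝ᵥ A *ᵥ X = Z ⬝ᵥ A *ᵥ Y) : X = Y :=
  Matrix.mulVec_injective_of_isUnit ((Matrix.isUnit_iff_isUnit_det A).2 hA)
    (dotProduct_eq _ _ fun Z => by rw [dotProduct_comm, h, dotProduct_comm])

theorem fderiv_dotProduct_mulVec (hg : ∀ i j, DifferentiableAt ℝ (fun q => g q i j) p)
    (X Y Z : Fin n → ℝ) :
    fderiv ℝ (fun q => Y ⬝ᵥ g q *ᵥ Z) p X
      = ∑ i, ∑ j, ∑ r, partialD i (fun q => g q j r) p * X i * Y j * Z r := by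
  have hderiv : HasFDerivAt (fun q => Y ⬝ᵥ g q *ᵥ Z)
      (∑ j, Y j • ∑ r, Z r • fderiv ℝ (fun q => g q j r) p) p := by
    simp only [dotProduct, Matrix.mulVec]
    exact HasFDerivAt.fun_sum fun j _ =>
      (HasFDerivAt.fun_sum fun r _ => (hg j r).hasFDerivAt.mul_const (Z r)).const_mul (Y j)
  rw [hderiv.fderiv, Finset.sum_comm]
  simp only [_root_.sum_apply, _root_.smul_apply,
    fderiv_eq_sum_partialD, smul_eq_mul, Finset.mul_sum]
  refine Finset.sum_congr rfl fun j _ => ?_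
  rw [Finset.sum_comm]
  exact Finset.sum_congr rfl fun i _ => Finset.sum_congr rfl fun r _ => by ring

theorem two_mul_sum_mul_christoffel (hdet : IsUnit (g p).det) (r i j : Fin n) :
    2 * ∑ k, g p r k * christoffel g k i j p
      = partialD i (fun q => g q j r) p + partialD j (fun q => g q i r) p
        - partialD r (fun q => g q i j) p := by
  have h := congr_fun (congr_arg (· *ᵥ fun s => partialD i (fun q => g q j s) p
    + partialD j (fun q => g q i s) p - partialD s (fun q => g q i j) p)
    (Matrix.mul_nonsing_inv _ hdet)) r
  rw [Matrix.one_mulVec, ← Matrix.mulVec_mulVec] at h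
  rw [← h, Matrix.mulVec, dotProduct, Finset.mul_sum]
  refine Finset.sum_congr rfl fun k _ => ?_
  rw [christoffel, Matrix.mulVec, dotProduct]
  ring

theorem koszul_formula (hg : ∀ i j, DifferentiableAt ℝ (fun q => g q i j) p)
    (hdet : IsUnit (g p).det) (X Y Z : Fin n → ℝ) :
    2 * (Z ⬝ᵥ g p *ᵥ christoffelOp g p X Y)
      = fderiv ℝ (fun q => Y ⬝ᵥ g q *ᵥ Z) p X + fderiv ℝ (fun q => X ⬝ᵥ g q *ᵥ Z) p Y
        - fderiv ℝ (fun q => X ⬝ᵥ g q *ᵥ Y) p Z := by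
  calc 2 * (Z ⬝ᵥ g p *ᵥ christoffelOp g p X Y)
      = ∑ r, ∑ i, ∑ j, (2 * ∑ k, g p r k * christoffel g k i j p) * X i * Y j * Z r := by
        simp only [dotProduct, Matrix.mulVec, christoffelOp, Finset.mul_sum, Finset.sum_mul]
        refine Finset.sum_congr rfl fun r _ => ?_
        rw [Finset.sum_comm]
        refine Finset.sum_congr rfl fun i _ => ?_
        rw [Finset.sum_comm]
        exact Finset.sum_congr rfl fun j _ => Finset.sum_congr rfl fun k _ => by ring
    _ = _ := by
        simp only [two_mul_sum_mul_christoffel hdet, fderiv_dotProduct_mulVec hg, sub_mul, add_mul,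
          Finset.sum_sub_distrib, Finset.sum_add_distrib]
        refine congr_arg₂ _ (congr_arg₂ _ ?_ ?_) ?_
        · rw [Finset.sum_comm]
          exact Finset.sum_congr rfl fun i _ => Finset.sum_comm
        · refine Eq.trans (Finset.sum_congr rfl fun r _ => Finset.sum_comm) ?_
          rw [Finset.sum_comm]
          refine Finset.sum_congr rfl fun j _ => ?_
          rw [Finset.sum_comm]
          exact Finset.sum_congr rfl fun i _ => Finset.sum_congr rfl fun r _ => by ring
        · exact Finset.sum_congr rfl fun r _ => Finset.sum_congr rfl fun i _ =>
            Finset.sum_congr rfl fun j _ => by ring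

theorem fderiv_christoffelOp_apply (hΓ : ∀ k i j, DifferentiableAt ℝ (christoffel g k i j) p)
    (X Y Z : Fin n → ℝ) (a : Fin n) :
    fderiv ℝ (fun q => christoffelOp g q Y Z) p X a
      = ∑ c, ∑ d, ∑ b, partialD c (christoffel g a d b) p * X c * Y d * Z b := by
  have hderiv : HasFDerivAt (fun q => christoffelOp g q Y Z)
      (ContinuousLinearMap.pi fun k =>
        ∑ d, ∑ b, Z b • Y d • fderiv ℝ (christoffel g k d b) p) p :=
    hasFDerivAt_pi.2 fun k => HasFDerivAt.fun_sum fun d _ => HasFDerivAt.fun_sum fun b _ =>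
      ((hΓ k d b).hasFDerivAt.mul_const (Y d)).mul_const (Z b)
  rw [hderiv.fderiv, ContinuousLinearMap.pi_apply]
  simp only [_root_.sum_apply, _root_.smul_apply, fderiv_eq_sum_partialD, smul_eq_mul,
    Finset.mul_sum]
  refine Eq.trans (Finset.sum_congr rfl fun d _ => ?_) Finset.sum_comm
  rw [Finset.sum_comm]
  exact Finset.sum_congr rfl fun c _ => Finset.sum_congr rfl fun b _ => by ring

theorem christoffelOp_christoffelOp_apply (X Y Z : Fin n → ℝ) (a : Fin n) :
    christoffelOp g p X (christoffelOp g p Y Z) a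
      = ∑ c, ∑ d, ∑ b, (∑ e, christoffel g a c e p * christoffel g e d b p) * X c * Y d * Z b := by
  simp only [christoffelOp, Finset.mul_sum, Finset.sum_mul]
  refine Finset.sum_congr rfl fun c _ => ?_
  rw [Finset.sum_comm]
  refine Finset.sum_congr rfl fun d _ => ?_
  rw [Finset.sum_comm]
  exact Finset.sum_congr rfl fun b _ => Finset.sum_congr rfl fun e _ => by ring

theorem curvatureOp_eq
    (hΓ : ∀ X Y, DifferentiableAt ℝ (fun q => christoffelOp g q X Y) p) (X Y Z : Fin n → ℝ) :
    curvatureOp g p X Y Z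
      = fderiv ℝ (fun q => christoffelOp g q Y Z) p X
        - fderiv ℝ (fun q => christoffelOp g q X Z) p Y
        + christoffelOp g p X (christoffelOp g p Y Z)
        - christoffelOp g p Y (christoffelOp g p X Z) := by
  have hcomp (k i j) : DifferentiableAt ℝ (christoffel g k i j) p := by
    simpa only [christoffelOp_single] using
      differentiableAt_pi.1 (hΓ (Pi.single i 1) (Pi.single j 1)) k
  ext a
  have swap (T : Fin n → Fin n → Fin n → ℝ) :
      ∑ c, ∑ d, ∑ b, T c d b * Y c * X d * Z b = ∑ c, ∑ d, ∑ b, T d c b * X c * Y d * Z b := by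
    rw [Finset.sum_comm]
    exact Finset.sum_congr rfl fun c _ => Finset.sum_congr rfl fun d _ =>
      Finset.sum_congr rfl fun b _ => by ring
  simp only [Pi.sub_apply, Pi.add_apply, fderiv_christoffelOp_apply hcomp,
    christoffelOp_christoffelOp_apply, swap, ← Finset.sum_sub_distrib, ← Finset.sum_add_distrib]
  rw [curvatureOp, Finset.sum_comm]
  refine Finset.sum_congr rfl fun c _ => ?_
  rw [Finset.sum_comm]
  refine Finset.sum_congr rfl fun d _ => Finset.sum_congr rfl fun b _ => ?_
  rw [curvature, Finset.sum_sub_distrib]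
  ring

theorem christoffel_congr (h : g =ᶠ[𝓝 p] g') (r i j : Fin n) :
    christoffel g r i j p = christoffel g' r i j p := by
  have hentry (i j) : (fun q => g q i j) =ᶠ[𝓝 p] fun q => g' q i j :=
    h.fun_comp fun A => A i j
  simp only [christoffel, h.eq_of_nhds, partialD_congr (hentry _ _)]

end Chart

section PullbackConnection

variable {k n : ℕ} {g g' : (Fin k → ℝ) → Matrix (Fin k) (Fin k) ℝ}
  {h : (Fin n → ℝ) → Matrix (Fin n) (Fin n) ℝ} {φ : (Fin k → ℝ) → (Fin n → ℝ)}
  {W W' : (Fin k → ℝ) → (Fin n → ℝ)} {p X : Fin k → ℝ}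

/-- The covariant derivative `∇^φ_X W` at `p` of a vector field `W` along `φ`, in the direction
of an arbitrary tangent vector `X`. -/
def covariantDeriv (h : (Fin n → ℝ) → Matrix (Fin n) (Fin n) ℝ) (φ : (Fin k → ℝ) → (Fin n → ℝ))
    (X : Fin k → ℝ) (W : (Fin k → ℝ) → (Fin n → ℝ)) (p : Fin k → ℝ) : Fin n → ℝ :=
  fderiv ℝ W p X + christoffelOp h (φ p) (fderiv ℝ φ p X) (W p)

theorem pullbackD_eq_covariantDeriv (i : Fin k) :
    pullbackD h φ i W p = covariantDeriv h φ (Pi.single i 1) W p :=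
  rfl

theorem covariantDeriv_add_direction (X₁ X₂ : Fin k → ℝ) :
    covariantDeriv h φ (X₁ + X₂) W p
      = covariantDeriv h φ X₁ W p + covariantDeriv h φ X₂ W p := by
  simp only [covariantDeriv, map_add, christoffelOp_add_left]
  abel

theorem covariantDeriv_smul_direction (a : ℝ) :
    covariantDeriv h φ (a • X) W p = a • covariantDeriv h φ X W p := by
  simp only [covariantDeriv, map_smul, christoffelOp_smul_left, smul_add]

theorem covariantDeriv_add (hW : DifferentiableAt ℝ W p) (hW' : DifferentiableAt ℝ W' p) :
    covariantDeriv h φ X (W + W') p = covariantDeriv h φ X W p + covariantDeriv h φ X W' p := by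
  simp only [covariantDeriv, fderiv_add hW hW', Pi.add_apply, christoffelOp_add_right,
    _root_.add_apply]
  abel

theorem covariantDeriv_smul {a : (Fin k → ℝ) → ℝ} (ha : DifferentiableAt ℝ a p)
    (hW : DifferentiableAt ℝ W p) :
    covariantDeriv h φ X (a • W) p = fderiv ℝ a p X • W p + a p • covariantDeriv h φ X W p := by
  rw [covariantDeriv, covariantDeriv, fderiv_smul ha hW, Pi.smul_apply', christoffelOp_smul_right]
  simp only [_root_.add_apply, _root_.smul_apply, ContinuousLinearMap.smulRight_apply, smul_add]
  abel

theorem covariantDeriv_congr (hW : W =ᶠ[𝓝 p] W') :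
    covariantDeriv h φ X W p = covariantDeriv h φ X W' p := by
  rw [covariantDeriv, covariantDeriv, hW.fderiv_eq, hW.eq_of_nhds]

theorem tension_congr (hg : g =ᶠ[𝓝 p] g') : tension g h φ p = tension g' h φ p := by
  simp only [tension, hg.eq_of_nhds, christoffel_congr hg]

theorem bitension_congr (hg : g =ᶠ[𝓝 p] g') : bitension g h φ p = bitension g' h φ p := by
  have htension : tension g h φ =ᶠ[𝓝 p] tension g' h φ :=
    hg.eventuallyEq_nhds.mono fun q hq => tension_congr hq
  have hpullback (i) : pullbackD h φ i (tension g h φ) =ᶠ[𝓝 p] pullbackD h φ i (tension g' h φ) :=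
    htension.eventuallyEq_nhds.mono fun q hq => covariantDeriv_congr hq
  have hpullback₂ (i j) : pullbackD h φ i (pullbackD h φ j (tension g h φ)) p
      = pullbackD h φ i (pullbackD h φ j (tension g' h φ)) p :=
    covariantDeriv_congr (hpullback j)
  simp only [bitension, hg.eq_of_nhds, christoffel_congr hg, htension.eq_of_nhds,
    (hpullback _).eq_of_nhds, hpullback₂]

end PullbackConnection

/-! ### The metric induced on a Hopf cylinder -/

section ShearMetric

variable {θ : ℝ → ℝ} {f : (Fin 2 → ℝ) → ℝ} {p : Fin 2 → ℝ} {d : ℝ}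

/-- The metric `f⁻¹ (ds² + (θ(s) ds + dz)²)` on the `(s, z)`-plane: up to the conformal factor,
the metric induced on a Hopf cylinder. -/
def shearMetric (θ : ℝ → ℝ) (f : (Fin 2 → ℝ) → ℝ) (p : Fin 2 → ℝ) : Matrix (Fin 2) (Fin 2) ℝ :=
  (f p)⁻¹ • !![1 + θ (p 0) ^ 2, θ (p 0); θ (p 0), 1]

/-- The vector field `∂ₛ - θ(s) ∂_z`, which completes `∂_z` to an orthogonal frame of
`shearMetric θ f`. -/
def shearField (θ : ℝ → ℝ) (p : Fin 2 → ℝ) : Fin 2 → ℝ := ![1, -θ (p 0)]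

theorem shearField_eq (θ : ℝ → ℝ) (p : Fin 2 → ℝ) :
    shearField θ p = Pi.single 0 1 + (-θ (p 0)) • Pi.single 1 1 := by
  ext i
  fin_cases i <;> simp [shearField]

theorem shearField_zero (θ : ℝ → ℝ) (p : Fin 2 → ℝ) : shearField θ p 0 = 1 := rfl

theorem shearField_one (θ : ℝ → ℝ) (p : Fin 2 → ℝ) : shearField θ p 1 = -θ (p 0) := rfl

theorem inv_shearMetric (hf : f p ≠ 0) :
    (shearMetric θ f p)⁻¹ = f p • !![1, -θ (p 0); -θ (p 0), 1 + θ (p 0) ^ 2] := by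
  refine Matrix.inv_eq_right_inv ?_
  ext i j
  fin_cases i <;> fin_cases j <;> simp [shearMetric, Matrix.mul_apply] <;> field_simp <;> ring

theorem isUnit_det_shearMetric (hf : f p ≠ 0) : IsUnit (shearMetric θ f p).det := by
  have : (shearMetric θ f p).det = (f p)⁻¹ ^ 2 := by
    simp [shearMetric, Matrix.det_fin_two]
    ring
  simp [this, hf]

theorem trace_shearMetric {M : Type*} [AddCommGroup M] [Module ℝ M] (hf : f p ≠ 0)
    (S : Fin 2 → Fin 2 → M) :
    ∑ i, ∑ j, (shearMetric θ f p)⁻¹ i j • S i j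
      = f p • (S 0 0 - θ (p 0) • (S 0 1 + S 1 0) + (1 + θ (p 0) ^ 2) • S 1 1) := by
  simp only [inv_shearMetric hf, Fin.sum_univ_two, Matrix.smul_apply, Matrix.of_apply,
    Matrix.cons_val', Matrix.cons_val_zero, Matrix.cons_val_one, Matrix.cons_val_fin_one,
    smul_eq_mul]
  module

theorem dotProduct_shearMetric (X Y : Fin 2 → ℝ) :
    X ⬝ᵥ shearMetric θ f p *ᵥ Y
      = (f p)⁻¹ * (X 0 * Y 0 + (θ (p 0) * X 0 + X 1) * (θ (p 0) * Y 0 + Y 1)) := by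
  simp only [shearMetric, dotProduct, Matrix.mulVec, Fin.sum_univ_two, Matrix.smul_apply,
    Matrix.of_apply, Matrix.cons_val', Matrix.cons_val_zero, Matrix.cons_val_one,
    Matrix.cons_val_fin_one, smul_eq_mul, mul_one]
  ring

theorem hasFDerivAt_comp_zero {E : Type*} [NormedAddCommGroup E] [NormedSpace ℝ E] {w : ℝ → E}
    {w' : E} (hw : HasDerivAt w w' (p 0)) :
    HasFDerivAt (fun q : Fin 2 → ℝ => w (q 0))
      ((ContinuousLinearMap.proj (R := ℝ) (φ := fun _ : Fin 2 => ℝ) 0).smulRight w') p := by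
  refine (HasFDerivAt.comp p hw.hasFDerivAt (hasFDerivAt_apply 0 p)).congr_fderiv ?_
  ext
  simp

theorem differentiableAt_shearMetric (hθ : HasDerivAt θ d (p 0)) (hf : DifferentiableAt ℝ f p)
    (hf₀ : f p ≠ 0) (i j : Fin 2) : DifferentiableAt ℝ (fun q => shearMetric θ f q i j) p := by
  have hθ' := (hasFDerivAt_comp_zero hθ).differentiableAt
  refine (hf.fun_inv hf₀).fun_mul (b := fun q => !![1 + θ (q 0) ^ 2, θ (q 0); θ (q 0), 1] i j) ?_
  fin_cases i <;> fin_cases j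
  exacts [(hθ'.fun_pow 2).const_add 1, hθ', hθ', differentiableAt_const 1]

theorem fderiv_dotProduct_shearMetric (hθ : HasDerivAt θ d (p 0))
    (hf : DifferentiableAt ℝ f p) (hf₀ : f p ≠ 0) (X Y Z : Fin 2 → ℝ) :
    fderiv ℝ (fun q => X ⬝ᵥ shearMetric θ f q *ᵥ Y) p Z
      = fderiv ℝ (fun q => (f q)⁻¹) p Z
          * (X 0 * Y 0 + (θ (p 0) * X 0 + X 1) * (θ (p 0) * Y 0 + Y 1))
        + (f p)⁻¹ * (d * Z 0 * (X 0 * (θ (p 0) * Y 0 + Y 1) + (θ (p 0) * X 0 + X 1) * Y 0)) := by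
  have hθ' := hasFDerivAt_comp_zero hθ
  simp only [dotProduct_shearMetric]
  rw [HasFDerivAt.fderiv ((hf.fun_inv hf₀).hasFDerivAt.fun_mul
    ((((hθ'.mul_const (X 0)).add_const (X 1)).fun_mul
      ((hθ'.mul_const (Y 0)).add_const (Y 1))).const_add (X 0 * Y 0)))]
  simp only [smul_add, _root_.add_apply, _root_.smul_apply, ContinuousLinearMap.smulRight_apply,
    ContinuousLinearMap.proj_apply, smul_eq_mul]
  ring

theorem christoffelOp_shearMetric (hθ : HasDerivAt θ d (p 0)) (hf : DifferentiableAt ℝ f p)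
    (hf₀ : f p ≠ 0) :
    christoffelOp (shearMetric θ f) p (shearField θ p) (shearField θ p)
        + christoffelOp (shearMetric θ f) p (Pi.single 1 1) (Pi.single 1 1)
      = d • Pi.single 1 1 := by
  refine eq_of_dotProduct_mulVec_eq (isUnit_det_shearMetric (θ := θ) hf₀) fun Z => ?_
  have hkoszul := koszul_formula (differentiableAt_shearMetric hθ hf hf₀)
    (isUnit_det_shearMetric hf₀)
  have hframe := hkoszul (shearField θ p) (shearField θ p) Z
  have hfibre := hkoszul (Pi.single 1 1) (Pi.single 1 1) Z
  rw [Matrix.mulVec_add, dotProduct_add, dotProduct_shearMetric Z (d • Pi.single 1 1)]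
  simp only [fderiv_dotProduct_shearMetric hθ hf hf₀, fderiv_eq_sum_partialD, Fin.sum_univ_two,
    shearField_zero, shearField_one, smul_eq_mul, Pi.smul_apply, Pi.single_eq_same,
    Pi.single_eq_of_ne zero_ne_one] at hframe hfibre ⊢
  linear_combination (hframe + hfibre) / 2

theorem sum_christoffel_shearMetric_smul (hθ : HasDerivAt θ d (p 0)) (hf : DifferentiableAt ℝ f p)
    (hf₀ : f p ≠ 0) {M : Type*} [AddCommGroup M] [Module ℝ M] (P : Fin 2 → M) :
    ∑ i, ∑ j, (shearMetric θ f p)⁻¹ i j • ∑ r, christoffel (shearMetric θ f) r i j p • P r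
      = f p • d • P 1 := by
  have hΓ (r : Fin 2) := congr_fun (christoffelOp_shearMetric hθ hf hf₀) r
  simp only [shearField_eq, christoffelOp_add_left, christoffelOp_add_right,
    christoffelOp_smul_left, christoffelOp_smul_right, Pi.add_apply, Pi.smul_apply,
    christoffelOp_single, smul_eq_mul] at hΓ
  have hΓ₀ := hΓ 0
  have hΓ₁ := hΓ 1
  rw [Pi.single_eq_of_ne zero_ne_one] at hΓ₀
  rw [Pi.single_eq_same] at hΓ₁
  rw [trace_shearMetric hf₀]
  simp only [Fin.sum_univ_two]
  linear_combination (norm := module) f p • hΓ₀ • P 0 + f p • hΓ₁ • P 1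

theorem trace_pullbackD_shearMetric {n : ℕ} {h : (Fin n → ℝ) → Matrix (Fin n) (Fin n) ℝ}
    {φ : (Fin 2 → ℝ) → (Fin n → ℝ)} {P : Fin 2 → (Fin 2 → ℝ) → (Fin n → ℝ)}
    (hθ : HasDerivAt θ d (p 0)) (hf : DifferentiableAt ℝ f p) (hf₀ : f p ≠ 0)
    (hP : ∀ j, DifferentiableAt ℝ (P j) p) :
    ∑ i, ∑ j, (shearMetric θ f p)⁻¹ i j •
        (pullbackD h φ i (P j) p - ∑ r, christoffel (shearMetric θ f) r i j p • P r p)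
      = f p • (covariantDeriv h φ (shearField θ p) (fun q => P 0 q + (-θ (q 0)) • P 1 q) p
        + covariantDeriv h φ (Pi.single 1 1) (P 1) p) := by
  have hθ' := hasFDerivAt_comp_zero hθ.fun_neg
  have hshear (X : Fin 2 → ℝ) :
      covariantDeriv h φ X (fun q => P 0 q + (-θ (q 0)) • P 1 q) p
        = covariantDeriv h φ X (P 0) p + (X 0 * -d) • P 1 p
          + (-θ (p 0)) • covariantDeriv h φ X (P 1) p := by
    have hsmul := covariantDeriv_smul (h := h) (φ := φ) (X := X) hθ'.differentiableAt (hP 1)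
    rw [hθ'.fderiv] at hsmul
    have hadd := covariantDeriv_add (h := h) (φ := φ) (X := X) (hP 0)
      (hθ'.differentiableAt.smul (hP 1))
    exact hadd.trans (by rw [add_assoc]; exact congr_arg _ hsmul)
  simp only [smul_sub, Finset.sum_sub_distrib, sum_christoffel_shearMetric_smul hθ hf hf₀,
    trace_shearMetric hf₀, pullbackD_eq_covariantDeriv]
  rw [shearField_eq, hshear]
  simp only [covariantDeriv_add_direction, covariantDeriv_smul_direction, Pi.add_apply,
    Pi.smul_apply]
  simp only [Pi.single_eq_same, Pi.single_eq_of_ne zero_ne_one]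
  module

end ShearMetric

section ShearDerivative

variable {θ : ℝ → ℝ} {d : ℝ} {p : Fin 2 → ℝ} {U : Set (Fin 2 → ℝ)} {u : (Fin 2 → ℝ) → ℝ}

/-- The derivative of `u` along `∂ₛ - θ(s) ∂_z`. -/
def shearDeriv (θ : ℝ → ℝ) (u : (Fin 2 → ℝ) → ℝ) (q : Fin 2 → ℝ) : ℝ :=
  fderiv ℝ u q (shearField θ q)

theorem hasFDerivAt_shearField (hθ : HasDerivAt θ d (p 0)) :
    HasFDerivAt (shearField θ)
      ((ContinuousLinearMap.proj (R := ℝ) (φ := fun _ : Fin 2 => ℝ) 0).smulRight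
        ((-d) • (Pi.single 1 1 : Fin 2 → ℝ))) p := by
  simp only [funext (shearField_eq θ)]
  exact hasFDerivAt_comp_zero (w := fun t => (Pi.single 0 1 + (-θ t) • Pi.single 1 1 : Fin 2 → ℝ))
    ((hθ.fun_neg.smul_const _).const_add _)

theorem differentiableAt_shearDeriv (hU : IsOpen U) (hu : ContDiffOn ℝ ∞ u U) (hp : p ∈ U)
    (hθ : HasDerivAt θ d (p 0)) : DifferentiableAt ℝ (shearDeriv θ u) p :=
  (differentiableAt_of_contDiffOn hU (hu.fderiv_of_isOpen hU (m := ∞) (by simp)) hp).clm_apply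
    (hasFDerivAt_shearField hθ).differentiableAt

theorem partialD_one_shearDeriv (hU : IsOpen U) (hu : ContDiffOn ℝ ∞ u U) (hp : p ∈ U)
    (hθ : HasDerivAt θ d (p 0)) :
    partialD 1 (shearDeriv θ u) p = shearDeriv θ (partialD 1 u) p := by
  have hsymm : IsSymmSndFDerivAt ℝ u p := (hu.contDiffAt (hU.mem_nhds hp)).isSymmSndFDerivAt (by
    rw [minSmoothness_of_isRCLikeNormedField]
    exact WithTop.coe_le_coe.2 (le_top : (2 : ℕ∞) ≤ ⊤))
  have hu' := differentiableAt_of_contDiffOn hU (hu.fderiv_of_isOpen hU (m := ∞) (by simp)) hp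
  have hE := hasFDerivAt_shearField hθ
  unfold partialD shearDeriv
  rw [fderiv_clm_apply hu' hE.differentiableAt, hE.fderiv,
    fderiv_clm_apply hu' (differentiableAt_const _)]
  simp [hsymm.eq (Pi.single 1 1)]

end ShearDerivative

/-! ### The connection and the curvature of `M³(m, l)` -/

section BaseSurface

variable {m l : ℝ} {q v w : Fin 2 → ℝ}

/-- Rotation of a plane vector by a quarter turn. -/
def rot (u : Fin 2 → ℝ) : Fin 2 → ℝ := ![-u 1, u 0]

theorem rot_add (u v : Fin 2 → ℝ) : rot (u + v) = rot u + rot v := by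
  ext i
  fin_cases i <;> simp [rot]
  ring

theorem rot_smul (a : ℝ) (u : Fin 2 → ℝ) : rot (a • u) = a • rot u := by
  ext i
  fin_cases i <;> simp [rot]

theorem rot_rot (u : Fin 2 → ℝ) : rot (rot u) = -u := by
  ext i
  fin_cases i <;> simp [rot]

theorem rot_dotProduct_self (u : Fin 2 → ℝ) : rot u ⬝ᵥ u = 0 := by
  simp only [rot, dotProduct, Fin.sum_univ_two, Matrix.cons_val_zero, Matrix.cons_val_one,
    Matrix.cons_val_fin_one]
  ring

theorem rot_dotProduct_rot (u v : Fin 2 → ℝ) : rot u ⬝ᵥ rot v = u ⬝ᵥ v := by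
  simp only [rot, dotProduct, Fin.sum_univ_two, Matrix.cons_val_zero, Matrix.cons_val_one,
    Matrix.cons_val_fin_one]
  ring

theorem hasDerivAt_rot {Q : ℝ → Fin 2 → ℝ} {t : ℝ} (hQ : HasDerivAt Q v t) :
    HasDerivAt (fun s => rot (Q s)) (rot v) t := by
  refine hasDerivAt_pi.2 fun i => ?_
  fin_cases i
  exacts [(hasDerivAt_pi.1 hQ 1).fun_neg, hasDerivAt_pi.1 hQ 0]

theorem rot_dotProduct_smul_rot (u v w : Fin 2 → ℝ) :
    (rot u ⬝ᵥ v) • rot w = (u ⬝ᵥ w) • v - (v ⬝ᵥ w) • u := by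
  ext i
  simp only [rot, dotProduct, Fin.sum_univ_two, Matrix.cons_val_zero, Matrix.cons_val_one,
    Matrix.cons_val_fin_one, Pi.sub_apply, Pi.smul_apply, smul_eq_mul]
  fin_cases i <;> simp only [Fin.zero_eta, Fin.mk_one, Matrix.cons_val_zero, Matrix.cons_val_one,
    Matrix.cons_val_fin_one] <;> ring

/-- The projection `(x, y, z) ↦ (x, y)` onto the base surface. -/
def proj : (Fin 3 → ℝ) →L[ℝ] Fin 2 → ℝ :=
  ContinuousLinearMap.pi ![ContinuousLinearMap.proj 0, ContinuousLinearMap.proj 1]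

/-- The value of the 1-form `(l/2) (y dx - x dy) / F` at `q` on the vector `u`. -/
def contact (m l : ℝ) (q u : Fin 2 → ℝ) : ℝ :=
  l / 2 * (q 1 * u 0 - q 0 * u 1) / factor m (q 0) (q 1)

/-- The derivative of `q ↦ contact m l q u` in the direction `v`. Since `factor 0 _ _ = 1`, the
term `contact 0 l v u` is the derivative of the numerator of `contact m l q u`. -/
def contactDeriv (m l : ℝ) (q v u : Fin 2 → ℝ) : ℝ :=
  (contact 0 l v u - 2 * m * (q ⬝ᵥ v) * contact m l q u) / factor m (q 0) (q 1)

/-- The vector `Γ(u, v)` of the Levi-Civita connection of the conformal metric `|dq|² / F²`. -/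
def baseChristoffel (m : ℝ) (q u v : Fin 2 → ℝ) : Fin 2 → ℝ :=
  (-(2 * m) / factor m (q 0) (q 1)) • ((q ⬝ᵥ u) • v + (q ⬝ᵥ v) • u - (u ⬝ᵥ v) • q)

/-- The derivative of `q ↦ baseChristoffel m q u v` in the direction `w`. -/
def baseChristoffelDeriv (m : ℝ) (q w u v : Fin 2 → ℝ) : Fin 2 → ℝ :=
  (-(2 * m) / factor m (q 0) (q 1)) • ((w ⬝ᵥ u) • v + (w ⬝ᵥ v) • u - (u ⬝ᵥ v) • w
    + (q ⬝ᵥ w) • baseChristoffel m q u v)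

theorem baseChristoffel_curvature (hq : factor m (q 0) (q 1) ≠ 0) (u v w : Fin 2 → ℝ) :
    baseChristoffelDeriv m q u v w - baseChristoffelDeriv m q v u w
        + baseChristoffel m q u (baseChristoffel m q v w)
        - baseChristoffel m q v (baseChristoffel m q u w)
      = (4 * m / factor m (q 0) (q 1) ^ 2) • ((v ⬝ᵥ w) • u - (u ⬝ᵥ w) • v) := by
  ext i
  simp only [baseChristoffelDeriv, baseChristoffel, dotProduct, Fin.sum_univ_two, Pi.add_apply,
    Pi.sub_apply, Pi.smul_apply, smul_eq_mul]
  fin_cases i <;> field_simp <;> simp only [factor, Fin.zero_eta, Fin.mk_one] <;> ring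

theorem baseChristoffel_comm (u v : Fin 2 → ℝ) :
    baseChristoffel m q u v = baseChristoffel m q v u := by
  rw [baseChristoffel, baseChristoffel, dotProduct_comm u v, add_comm ((q ⬝ᵥ u) • v)]

theorem baseChristoffel_add_right (u v w : Fin 2 → ℝ) :
    baseChristoffel m q u (v + w) = baseChristoffel m q u v + baseChristoffel m q u w := by
  simp only [baseChristoffel, dotProduct_add]
  module

theorem baseChristoffel_smul_right (a : ℝ) (u v : Fin 2 → ℝ) :
    baseChristoffel m q u (a • v) = a • baseChristoffel m q u v := by
  simp only [baseChristoffel, dotProduct_smul, smul_eq_mul]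
  module

theorem baseChristoffel_rot_right (u v : Fin 2 → ℝ) :
    baseChristoffel m q u (rot v) = rot (baseChristoffel m q u v) := by
  ext i
  fin_cases i <;>
    simp [baseChristoffel, rot, dotProduct, Matrix.vecHead, Matrix.vecTail,
      -mul_eq_mul_left_iff] <;> ring

theorem contactDeriv_sub_contactDeriv (hq : factor m (q 0) (q 1) ≠ 0) (u v : Fin 2 → ℝ) :
    contactDeriv m l q u v - contactDeriv m l q v u
      = -l * (rot u ⬝ᵥ v) / factor m (q 0) (q 1) ^ 2 := by
  simp only [contactDeriv, contact, rot, dotProduct, Fin.sum_univ_two, Matrix.cons_val_zero,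
    Matrix.cons_val_one, Matrix.cons_val_fin_one]
  field_simp
  simp only [factor]
  ring

variable {E : Type*} [NormedAddCommGroup E] [NormedSpace ℝ E] {x : E} {Q R : E → Fin 2 → ℝ}

theorem differentiableAt_factor (hQ : DifferentiableAt ℝ Q x) :
    DifferentiableAt ℝ (fun y => factor m (Q y 0) (Q y 1)) x := by
  unfold factor
  fun_prop

theorem hasDerivAt_factor {Q : ℝ → Fin 2 → ℝ} {t : ℝ} (hQ : HasDerivAt Q v t) :
    HasDerivAt (fun s => factor m (Q s 0) (Q s 1)) (2 * m * (Q t ⬝ᵥ v)) t := by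
  have h := ((((hasDerivAt_pi.1 hQ 0).fun_pow 2).fun_add
    ((hasDerivAt_pi.1 hQ 1).fun_pow 2)).const_mul m).const_add 1
  refine h.congr_deriv ?_
  simp only [dotProduct, Fin.sum_univ_two]
  ring

theorem differentiableAt_contact (hQ : DifferentiableAt ℝ Q x) (hR : DifferentiableAt ℝ R x)
    (hx : factor m (Q x 0) (Q x 1) ≠ 0) :
    DifferentiableAt ℝ (fun y => contact m l (Q y) (R y)) x := by
  have hF := differentiableAt_factor (m := m) hQ
  unfold contact
  fun_prop (disch := assumption)

theorem hasDerivAt_contact {Q R : ℝ → Fin 2 → ℝ} {t : ℝ} (hQ : HasDerivAt Q v t)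
    (hR : HasDerivAt R w t) (ht : factor m (Q t 0) (Q t 1) ≠ 0) :
    HasDerivAt (fun s => contact m l (Q s) (R s))
      (contactDeriv m l (Q t) v (R t) + contact m l (Q t) w) t := by
  have hnum := (((hasDerivAt_pi.1 hQ 1).fun_mul (hasDerivAt_pi.1 hR 0)).fun_sub
    ((hasDerivAt_pi.1 hQ 0).fun_mul (hasDerivAt_pi.1 hR 1))).const_mul (l / 2)
  refine (hnum.fun_div (hasDerivAt_factor hQ) ht).congr_deriv ?_
  have hfactor : factor 0 (v 0) (v 1) = 1 := by simp [factor]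
  rw [contactDeriv, contact, contact, contact, hfactor]
  field_simp
  ring

theorem fderiv_contact (hQ : DifferentiableAt ℝ Q x) (hR : DifferentiableAt ℝ R x)
    (hx : factor m (Q x 0) (Q x 1) ≠ 0) (X : E) :
    fderiv ℝ (fun y => contact m l (Q y) (R y)) x X
      = contactDeriv m l (Q x) (fderiv ℝ Q x X) (R x) + contact m l (Q x) (fderiv ℝ R x X) := by
  rw [← (differentiableAt_contact hQ hR hx).lineDeriv_eq_fderiv]
  simpa [lineDeriv] using (hasDerivAt_contact (hQ.hasFDerivAt.hasLineDerivAt X)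
    (hR.hasFDerivAt.hasLineDerivAt X) (by simpa using hx)).deriv

theorem differentiableAt_contactDeriv (hQ : DifferentiableAt ℝ Q x)
    (hx : factor m (Q x 0) (Q x 1) ≠ 0) (u v : Fin 2 → ℝ) :
    DifferentiableAt ℝ (fun y => contactDeriv m l (Q y) u v) x := by
  have hfactor := differentiableAt_factor (m := m) hQ
  have hcontact := differentiableAt_contact (l := l) hQ (differentiableAt_const v) hx
  simp only [contactDeriv, dotProduct, Fin.sum_univ_two]
  fun_prop (disch := assumption)

theorem fderiv_contactDeriv (hQ : DifferentiableAt ℝ Q x)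
    (hx : factor m (Q x 0) (Q x 1) ≠ 0) (u v : Fin 2 → ℝ) (X : E) :
    fderiv ℝ (fun y => contactDeriv m l (Q y) u v) x X
      = -2 * m * ((fderiv ℝ Q x X ⬝ᵥ u) * contact m l (Q x) v
          + (Q x ⬝ᵥ u) * contactDeriv m l (Q x) (fderiv ℝ Q x X) v
          + (Q x ⬝ᵥ fderiv ℝ Q x X) * contactDeriv m l (Q x) u v) / factor m (Q x 0) (Q x 1) := by
  rw [← (differentiableAt_contactDeriv hQ hx u v).lineDeriv_eq_fderiv]
  have hline := hQ.hasFDerivAt.hasLineDerivAt X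
  have hzero : Q (x + (0 : ℝ) • X) = Q x := by simp
  have hdot : HasDerivAt (fun t : ℝ => Q (x + t • X) ⬝ᵥ u) (fderiv ℝ Q x X ⬝ᵥ u) 0 := by
    simpa only [dotProduct, Fin.sum_univ_two] using
      ((hasDerivAt_pi.1 hline 0).mul_const _).fun_add ((hasDerivAt_pi.1 hline 1).mul_const _)
  have hcontact := hasDerivAt_contact (m := m) (l := l) hline (hasDerivAt_const 0 v)
    (by rwa [hzero])
  refine ((((hdot.const_mul (2 * m)).fun_mul hcontact).const_sub (contact 0 l u v)).fun_div
    (hasDerivAt_factor (m := m) hline) (by rwa [hzero])).deriv.trans ?_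
  have hcontact_zero : contact m l (Q x) 0 = 0 := by simp [contact]
  rw [hzero, hcontact_zero, contactDeriv, contactDeriv]
  field_simp
  ring

theorem differentiableAt_baseChristoffel (hQ : DifferentiableAt ℝ Q x)
    (hx : factor m (Q x 0) (Q x 1) ≠ 0) (u v : Fin 2 → ℝ) :
    DifferentiableAt ℝ (fun y => baseChristoffel m (Q y) u v) x := by
  have hfactor := differentiableAt_factor (m := m) hQ
  simp only [baseChristoffel, dotProduct, Fin.sum_univ_two]
  fun_prop (disch := assumption)

theorem fderiv_baseChristoffel (hQ : DifferentiableAt ℝ Q x)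
    (hx : factor m (Q x 0) (Q x 1) ≠ 0) (u v : Fin 2 → ℝ) (X : E) :
    fderiv ℝ (fun y => baseChristoffel m (Q y) u v) x X
      = baseChristoffelDeriv m (Q x) (fderiv ℝ Q x X) u v := by
  rw [← (differentiableAt_baseChristoffel hQ hx u v).lineDeriv_eq_fderiv]
  have hline := hQ.hasFDerivAt.hasLineDerivAt X
  have hzero : Q (x + (0 : ℝ) • X) = Q x := by simp
  have hdot (w : Fin 2 → ℝ) :
      HasDerivAt (fun t : ℝ => Q (x + t • X) ⬝ᵥ w) (fderiv ℝ Q x X ⬝ᵥ w) 0 := by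
    simpa only [dotProduct, Fin.sum_univ_two] using
      ((hasDerivAt_pi.1 hline 0).mul_const _).fun_add ((hasDerivAt_pi.1 hline 1).mul_const _)
  refine (((hasDerivAt_const 0 (-(2 * m))).fun_div (hasDerivAt_factor (m := m) hline)
    (by rwa [hzero])).fun_smul ((((hdot u).smul_const v).fun_add ((hdot v).smul_const u)).fun_sub
      (hline.fun_const_smul (u ⬝ᵥ v)))).deriv.trans ?_
  rw [hzero, baseChristoffelDeriv, baseChristoffel]
  match_scalars <;> field_simp <;> ring

end BaseSurface

section HorizontalLift

variable {m l : ℝ} {p : Fin 3 → ℝ} {q u : Fin 2 → ℝ}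

/-- The lift of the base vector `u` at `q` to a vector orthogonal to the fibre. -/
def horizontalLift (m l : ℝ) (q u : Fin 2 → ℝ) : Fin 3 → ℝ := ![u 0, u 1, -contact m l q u]

/-- The unit vector field `∂_z` tangent to the fibres. -/
def fiber : Fin 3 → ℝ := ![0, 0, 1]

theorem horizontalLift_add (u v : Fin 2 → ℝ) :
    horizontalLift m l q (u + v) = horizontalLift m l q u + horizontalLift m l q v := by
  ext i
  fin_cases i <;> simp [horizontalLift, contact]
  ring

theorem horizontalLift_smul (a : ℝ) (u : Fin 2 → ℝ) :
    horizontalLift m l q (a • u) = a • horizontalLift m l q u := by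
  ext i
  fin_cases i <;> simp [horizontalLift, contact]
  ring

theorem proj_horizontalLift : proj (horizontalLift m l q u) = u := by
  ext i
  fin_cases i <;> rfl

theorem proj_fiber : proj fiber = 0 := by
  ext i
  fin_cases i <;> rfl

theorem form_dotProduct (p X : Fin 3 → ℝ) :
    form m l p ⬝ᵥ X = contact m l (proj p) (proj X) + X 2 := by
  simp [form, contact, proj, dotProduct, Fin.sum_univ_three]
  ring

theorem dotProduct_metric (p X Y : Fin 3 → ℝ) :
    X ⬝ᵥ metric m l p *ᵥ Y
      = (proj X ⬝ᵥ proj Y) / factor m (p 0) (p 1) ^ 2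
        + (form m l p ⬝ᵥ X) * (form m l p ⬝ᵥ Y) := by
  simp [metric, dotProduct, Matrix.mulVec, Fin.sum_univ_three, Matrix.vecMulVec_apply, proj,
    Matrix.diagonal_apply]
  ring

theorem isUnit_det_metric (hp : p ∈ space m) : IsUnit (metric m l p).det := by
  have hF : factor m (p 0) (p 1) ≠ 0 := ne_of_gt hp
  have hdet : (metric m l p).det = (factor m (p 0) (p 1) ^ 4)⁻¹ := by
    simp [metric, Matrix.det_fin_three, form]
    field_simp
    ring
  simp [hdet, hF]

theorem isOpen_space (m : ℝ) : IsOpen (space m) :=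
  isOpen_lt continuous_const (by unfold factor; fun_prop)

theorem differentiableAt_dotProduct_form (hp : p ∈ space m) (X : Fin 3 → ℝ) :
    DifferentiableAt ℝ (fun q => form m l q ⬝ᵥ X) p := by
  simp only [form_dotProduct]
  exact (differentiableAt_contact proj.differentiableAt (differentiableAt_const _)
    (ne_of_gt hp)).add_const _

theorem fderiv_dotProduct_form (hp : p ∈ space m) (X Z : Fin 3 → ℝ) :
    fderiv ℝ (fun q => form m l q ⬝ᵥ X) p Z = contactDeriv m l (proj p) (proj Z) (proj X) := by
  simp only [form_dotProduct, fderiv_add_const]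
  rw [fderiv_contact proj.differentiableAt (differentiableAt_const _) (ne_of_gt hp)]
  simp [contact]

theorem factor_proj : factor m (proj p 0) (proj p 1) = factor m (p 0) (p 1) := rfl

theorem differentiableAt_div_factor_sq (hp : p ∈ space m) (a : ℝ) :
    DifferentiableAt ℝ (fun q : Fin 3 → ℝ => a / factor m (q 0) (q 1) ^ 2) p := by
  have hfactor : DifferentiableAt ℝ (fun q : Fin 3 → ℝ => factor m (q 0) (q 1)) p :=
    differentiableAt_factor proj.differentiableAt
  fun_prop (disch := exact pow_ne_zero 2 (ne_of_gt hp))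

theorem fderiv_div_factor_sq (hp : p ∈ space m) (a : ℝ) (Z : Fin 3 → ℝ) :
    fderiv ℝ (fun q : Fin 3 → ℝ => a / factor m (q 0) (q 1) ^ 2) p Z
      = -4 * m * (proj p ⬝ᵥ proj Z) * a / factor m (p 0) (p 1) ^ 3 := by
  have hF : factor m (p 0) (p 1) ≠ 0 := ne_of_gt hp
  rw [← (differentiableAt_div_factor_sq hp a).lineDeriv_eq_fderiv]
  have hline := hasDerivAt_factor (m := m) ((proj.hasFDerivAt (x := p)).hasLineDerivAt Z)
  have hdiv := (hasDerivAt_const 0 a).fun_div (hline.fun_pow 2) (by simpa [factor_proj] using hF)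
  refine hdiv.deriv.trans ?_
  simp only [zero_smul, add_zero, factor_proj]
  field_simp
  ring

theorem differentiableAt_dotProduct_metric (hp : p ∈ space m) (X Y : Fin 3 → ℝ) :
    DifferentiableAt ℝ (fun q => X ⬝ᵥ metric m l q *ᵥ Y) p := by
  simp only [dotProduct_metric]
  exact (differentiableAt_div_factor_sq hp _).fun_add
    ((differentiableAt_dotProduct_form hp X).fun_mul (differentiableAt_dotProduct_form hp Y))

theorem fderiv_dotProduct_metric (hp : p ∈ space m) (X Y Z : Fin 3 → ℝ) :
    fderiv ℝ (fun q => X ⬝ᵥ metric m l q *ᵥ Y) p Z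
      = -4 * m * (proj p ⬝ᵥ proj Z) * (proj X ⬝ᵥ proj Y) / factor m (p 0) (p 1) ^ 3
        + contactDeriv m l (proj p) (proj Z) (proj X) * (form m l p ⬝ᵥ Y)
        + (form m l p ⬝ᵥ X) * contactDeriv m l (proj p) (proj Z) (proj Y) := by
  have hbase := differentiableAt_div_factor_sq hp (proj X ⬝ᵥ proj Y)
  have hform := differentiableAt_dotProduct_form (l := l) hp
  simp only [dotProduct_metric]
  rw [fderiv_fun_add hbase ((hform X).fun_mul (hform Y)), fderiv_fun_mul (hform X) (hform Y)]
  simp only [_root_.add_apply, _root_.smul_apply, smul_eq_mul, fderiv_dotProduct_form hp,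
    fderiv_div_factor_sq hp]
  ring

theorem differentiableAt_metric (hp : p ∈ space m) (i j : Fin 3) :
    DifferentiableAt ℝ (fun q => metric m l q i j) p := by
  simpa using differentiableAt_dotProduct_metric hp (Pi.single i 1) (Pi.single j 1)

theorem form_horizontalLift_add_smul_fiber (p : Fin 3 → ℝ) (u : Fin 2 → ℝ) (a : ℝ) :
    form m l p ⬝ᵥ (horizontalLift m l (proj p) u + a • fiber) = a := by
  rw [form_dotProduct, map_add, map_smul, proj_horizontalLift, proj_fiber]
  simp [horizontalLift, fiber]

theorem dotProduct_metric_horizontalLift_add_smul_fiber (p Z : Fin 3 → ℝ) (u : Fin 2 → ℝ)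
    (a : ℝ) :
    Z ⬝ᵥ metric m l p *ᵥ (horizontalLift m l (proj p) u + a • fiber)
      = (proj Z ⬝ᵥ u) / factor m (p 0) (p 1) ^ 2 + (form m l p ⬝ᵥ Z) * a := by
  rw [dotProduct_metric, form_horizontalLift_add_smul_fiber, map_add, map_smul,
    proj_horizontalLift, proj_fiber, smul_zero, add_zero]

/-- The projection to the base of `Γ(X, Y)` for the metric of `M³(m, l)`. -/
def horizontalChristoffel (m l : ℝ) (p X Y : Fin 3 → ℝ) : Fin 2 → ℝ :=
  baseChristoffel m (proj p) (proj X) (proj Y)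
    - (l / 2) • ((form m l p ⬝ᵥ X) • rot (proj Y) + (form m l p ⬝ᵥ Y) • rot (proj X))

theorem rot_horizontalChristoffel (p X Y : Fin 3 → ℝ) :
    rot (horizontalChristoffel m l p X Y)
      = rot (baseChristoffel m (proj p) (proj X) (proj Y))
        + (l / 2) • ((form m l p ⬝ᵥ X) • proj Y + (form m l p ⬝ᵥ Y) • proj X) := by
  rw [horizontalChristoffel, sub_eq_add_neg, ← neg_smul, rot_add, rot_smul, rot_add, rot_smul,
    rot_smul, rot_rot, rot_rot]
  module

theorem baseChristoffel_horizontalChristoffel (p X Y : Fin 3 → ℝ) (u : Fin 2 → ℝ) :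
    baseChristoffel m (proj p) u (horizontalChristoffel m l p X Y)
      = baseChristoffel m (proj p) u (baseChristoffel m (proj p) (proj X) (proj Y))
        - (l / 2) • ((form m l p ⬝ᵥ X) • rot (baseChristoffel m (proj p) u (proj Y))
          + (form m l p ⬝ᵥ Y) • rot (baseChristoffel m (proj p) u (proj X))) := by
  rw [horizontalChristoffel, sub_eq_add_neg, ← neg_smul, baseChristoffel_add_right,
    baseChristoffel_smul_right, baseChristoffel_add_right, baseChristoffel_smul_right,
    baseChristoffel_smul_right, baseChristoffel_rot_right, baseChristoffel_rot_right]
  module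

/-- The component along the fibre of `Γ(X, Y)` for the metric of `M³(m, l)`. -/
def verticalChristoffel (m l : ℝ) (p X Y : Fin 3 → ℝ) : ℝ :=
  contactDeriv m l (proj p) (proj X) (proj Y)
    + l / 2 * (rot (proj X) ⬝ᵥ proj Y) / factor m (p 0) (p 1) ^ 2

theorem christoffelOp_metric (hp : p ∈ space m) (X Y : Fin 3 → ℝ) :
    christoffelOp (metric m l) p X Y
      = horizontalLift m l (proj p) (horizontalChristoffel m l p X Y)
        + verticalChristoffel m l p X Y • fiber := by
  have hF : factor m (p 0) (p 1) ≠ 0 := ne_of_gt hp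
  refine eq_of_dotProduct_mulVec_eq (isUnit_det_metric (l := l) hp) fun Z => ?_
  have hkoszul := koszul_formula (differentiableAt_metric (l := l) hp) (isUnit_det_metric hp) X Y Z
  simp only [fderiv_dotProduct_metric hp] at hkoszul
  have hXY := contactDeriv_sub_contactDeriv (l := l) (q := proj p) hF (proj X) (proj Y)
  have hXZ := contactDeriv_sub_contactDeriv (l := l) (q := proj p) hF (proj X) (proj Z)
  have hYZ := contactDeriv_sub_contactDeriv (l := l) (q := proj p) hF (proj Y) (proj Z)
  rw [dotProduct_metric_horizontalLift_add_smul_fiber, horizontalChristoffel, verticalChristoffel]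
  rw [factor_proj] at hXY hXZ hYZ
  generalize form m l p ⬝ᵥ X = a, form m l p ⬝ᵥ Y = b, form m l p ⬝ᵥ Z = c at *
  simp only [baseChristoffel, factor_proj, rot, dotProduct, Fin.sum_univ_two, Pi.smul_apply,
    Pi.sub_apply, Pi.add_apply, smul_eq_mul, Matrix.cons_val_zero, Matrix.cons_val_one,
    Matrix.cons_val_fin_one] at hkoszul hXY hXZ hYZ ⊢
  linear_combination hkoszul / 2 + a / 2 * hYZ + b / 2 * hXZ - c / 2 * hXY

end HorizontalLift

section Connection

variable {m l : ℝ} {k : ℕ} {φ : (Fin k → ℝ) → Fin 3 → ℝ} {x : Fin k → ℝ}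
  {u : (Fin k → ℝ) → Fin 2 → ℝ} {c : (Fin k → ℝ) → ℝ}

theorem horizontalLift_add_smul_fiber (q v : Fin 2 → ℝ) (a : ℝ) :
    horizontalLift m l q v + a • fiber = ![v 0, v 1, a - contact m l q v] := by
  ext i
  fin_cases i <;> simp [horizontalLift, fiber, neg_add_eq_sub]

theorem differentiableAt_horizontalLift_add_smul_fiber {Q : (Fin k → ℝ) → Fin 2 → ℝ}
    (hQ : DifferentiableAt ℝ Q x) (hx : factor m (Q x 0) (Q x 1) ≠ 0)
    (hu : DifferentiableAt ℝ u x) (hc : DifferentiableAt ℝ c x) :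
    DifferentiableAt ℝ (fun y => horizontalLift m l (Q y) (u y) + c y • fiber) x := by
  simp only [horizontalLift_add_smul_fiber]
  refine differentiableAt_pi.2 fun i => ?_
  fin_cases i
  exacts [differentiableAt_pi.1 hu 0, differentiableAt_pi.1 hu 1,
    hc.fun_sub (differentiableAt_contact hQ hu hx)]

theorem fderiv_horizontalLift_add_smul_fiber {Q : (Fin k → ℝ) → Fin 2 → ℝ}
    (hQ : DifferentiableAt ℝ Q x) (hx : factor m (Q x 0) (Q x 1) ≠ 0)
    (hu : DifferentiableAt ℝ u x) (hc : DifferentiableAt ℝ c x) (X : Fin k → ℝ) :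
    fderiv ℝ (fun y => horizontalLift m l (Q y) (u y) + c y • fiber) x X
      = horizontalLift m l (Q x) (fderiv ℝ u x X)
        + (fderiv ℝ c x X - contactDeriv m l (Q x) (fderiv ℝ Q x X) (u x)) • fiber := by
  have hdiff := differentiableAt_horizontalLift_add_smul_fiber (l := l) hQ hx hu hc
  simp only [horizontalLift_add_smul_fiber] at hdiff ⊢
  ext i
  refine (DFunLike.congr_fun (fderiv_apply hdiff i) X).symm.trans ?_
  fin_cases i
  · exact DFunLike.congr_fun (fderiv_apply hu 0) X
  · exact DFunLike.congr_fun (fderiv_apply hu 1) X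
  · simp [fderiv_fun_sub hc (differentiableAt_contact hQ hu hx), fderiv_contact hQ hu hx]
    ring

theorem covariantDeriv_horizontalLift_add_smul_fiber (hφ : DifferentiableAt ℝ φ x)
    (hx : φ x ∈ space m) (hu : DifferentiableAt ℝ u x) (hc : DifferentiableAt ℝ c x)
    (X : Fin k → ℝ) :
    covariantDeriv (metric m l) φ X
        (fun y => horizontalLift m l (proj (φ y)) (u y) + c y • fiber) x
      = horizontalLift m l (proj (φ x))
          (fderiv ℝ u x X + baseChristoffel m (proj (φ x)) (proj (fderiv ℝ φ x X)) (u x)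
            - (l / 2) • ((form m l (φ x) ⬝ᵥ fderiv ℝ φ x X) • rot (u x)
              + c x • rot (proj (fderiv ℝ φ x X))))
        + (fderiv ℝ c x X
            + l / 2 * (rot (proj (fderiv ℝ φ x X)) ⬝ᵥ u x) / factor m (φ x 0) (φ x 1) ^ 2)
          • fiber := by
  have hproj : fderiv ℝ (fun y => proj (φ y)) x X = proj (fderiv ℝ φ x X) :=
    DFunLike.congr_fun (proj.hasFDerivAt.comp x hφ.hasFDerivAt).fderiv X
  rw [covariantDeriv, fderiv_horizontalLift_add_smul_fiber (Q := fun y => proj (φ y))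
    (proj.differentiableAt.comp x hφ) (ne_of_gt hx) hu hc, christoffelOp_metric hx, hproj,
    horizontalChristoffel, verticalChristoffel, form_horizontalLift_add_smul_fiber, map_add,
    map_smul, proj_horizontalLift, proj_fiber, smul_zero, add_zero, add_sub_assoc,
    horizontalLift_add]
  module

end Connection

section Curvature

variable {m l : ℝ} {p : Fin 3 → ℝ}

theorem differentiableAt_horizontalChristoffel (hp : p ∈ space m) (X Y : Fin 3 → ℝ) :
    DifferentiableAt ℝ (fun q => horizontalChristoffel m l q X Y) p :=
  ((differentiableAt_baseChristoffel proj.differentiableAt (ne_of_gt hp) _ _).fun_sub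
    ((((differentiableAt_dotProduct_form hp X).smul_const _).fun_add
      ((differentiableAt_dotProduct_form hp Y).smul_const _)).fun_const_smul _))

theorem fderiv_horizontalChristoffel (hp : p ∈ space m) (X Y Z : Fin 3 → ℝ) :
    fderiv ℝ (fun q => horizontalChristoffel m l q X Y) p Z
      = baseChristoffelDeriv m (proj p) (proj Z) (proj X) (proj Y)
        - (l / 2) • (contactDeriv m l (proj p) (proj Z) (proj X) • rot (proj Y)
          + contactDeriv m l (proj p) (proj Z) (proj Y) • rot (proj X)) := by
  have hX := differentiableAt_dotProduct_form (l := l) hp X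
  have hY := differentiableAt_dotProduct_form (l := l) hp Y
  have hbase := differentiableAt_baseChristoffel (m := m) proj.differentiableAt
    (ne_of_gt hp) (proj X) (proj Y)
  unfold horizontalChristoffel
  rw [fderiv_fun_sub hbase (((hX.smul_const _).fun_add (hY.smul_const _)).fun_const_smul _),
    fderiv_fun_const_smul ((hX.smul_const _).fun_add (hY.smul_const _)),
    fderiv_fun_add (hX.smul_const _) (hY.smul_const _), fderiv_smul_const hX, fderiv_smul_const hY]
  simp only [_root_.sub_apply, _root_.add_apply, _root_.smul_apply,
    ContinuousLinearMap.smulRight_apply, fderiv_dotProduct_form hp,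
    fderiv_baseChristoffel proj.differentiableAt (ne_of_gt hp), proj.fderiv]

theorem differentiableAt_verticalChristoffel (hp : p ∈ space m) (X Y : Fin 3 → ℝ) :
    DifferentiableAt ℝ (fun q => verticalChristoffel m l q X Y) p :=
  (differentiableAt_contactDeriv proj.differentiableAt (ne_of_gt hp) _ _).fun_add
    (differentiableAt_div_factor_sq hp _)

theorem fderiv_verticalChristoffel (hp : p ∈ space m) (X Y Z : Fin 3 → ℝ) :
    fderiv ℝ (fun q => verticalChristoffel m l q X Y) p Z
      = -2 * m * ((proj Z ⬝ᵥ proj X) * contact m l (proj p) (proj Y)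
            + (proj p ⬝ᵥ proj X) * contactDeriv m l (proj p) (proj Z) (proj Y)
            + (proj p ⬝ᵥ proj Z) * contactDeriv m l (proj p) (proj X) (proj Y))
          / factor m (p 0) (p 1)
        - 2 * m * l * (proj p ⬝ᵥ proj Z) * (rot (proj X) ⬝ᵥ proj Y)
          / factor m (p 0) (p 1) ^ 3 := by
  unfold verticalChristoffel
  rw [fderiv_fun_add (differentiableAt_contactDeriv proj.differentiableAt (ne_of_gt hp) _ _)
    (differentiableAt_div_factor_sq hp _), _root_.add_apply, fderiv_div_factor_sq hp,
    fderiv_contactDeriv proj.differentiableAt (ne_of_gt hp), proj.fderiv, factor_proj]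
  ring

theorem christoffelOp_metric_eventuallyEq (hp : p ∈ space m) (X Y : Fin 3 → ℝ) :
    (fun q => christoffelOp (metric m l) q X Y) =ᶠ[𝓝 p] fun q =>
      horizontalLift m l (proj q) (horizontalChristoffel m l q X Y)
        + verticalChristoffel m l q X Y • fiber :=
  ((isOpen_space m).eventually_mem hp).mono fun _ hq => christoffelOp_metric hq X Y

theorem differentiableAt_christoffelOp_metric (hp : p ∈ space m) (X Y : Fin 3 → ℝ) :
    DifferentiableAt ℝ (fun q => christoffelOp (metric m l) q X Y) p := by
  refine DifferentiableAt.congr_of_eventuallyEq ?_ (christoffelOp_metric_eventuallyEq hp X Y)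
  exact differentiableAt_horizontalLift_add_smul_fiber proj.differentiableAt (ne_of_gt hp)
    (differentiableAt_horizontalChristoffel hp X Y) (differentiableAt_verticalChristoffel hp X Y)

/-- The projection to the base of `∇_X (Γ(Y, Z))`, for `X`, `Y`, `Z` with constant components. -/
def horizontalSecondChristoffel (m l : ℝ) (p X Y Z : Fin 3 → ℝ) : Fin 2 → ℝ :=
  baseChristoffelDeriv m (proj p) (proj X) (proj Y) (proj Z)
    - (l / 2) • (contactDeriv m l (proj p) (proj X) (proj Y) • rot (proj Z)
      + contactDeriv m l (proj p) (proj X) (proj Z) • rot (proj Y))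
    + baseChristoffel m (proj p) (proj X) (horizontalChristoffel m l p Y Z)
    - (l / 2) • ((form m l p ⬝ᵥ X) • rot (horizontalChristoffel m l p Y Z)
      + verticalChristoffel m l p Y Z • rot (proj X))

/-- The component along the fibre of `∇_X (Γ(Y, Z))`, for `X`, `Y`, `Z` with constant
components. -/
def verticalSecondChristoffel (m l : ℝ) (p X Y Z : Fin 3 → ℝ) : ℝ :=
  fderiv ℝ (fun q => verticalChristoffel m l q Y Z) p X
    + l / 2 * (rot (proj X) ⬝ᵥ horizontalChristoffel m l p Y Z) / factor m (p 0) (p 1) ^ 2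

theorem fderiv_add_christoffelOp_christoffelOp_metric (hp : p ∈ space m) (X Y Z : Fin 3 → ℝ) :
    fderiv ℝ (fun q => christoffelOp (metric m l) q Y Z) p X
        + christoffelOp (metric m l) p X (christoffelOp (metric m l) p Y Z)
      = horizontalLift m l (proj p) (horizontalSecondChristoffel m l p X Y Z)
        + verticalSecondChristoffel m l p X Y Z • fiber := by
  have h := covariantDeriv_horizontalLift_add_smul_fiber (l := l) differentiableAt_id hp
    (differentiableAt_horizontalChristoffel (l := l) hp Y Z)
    (differentiableAt_verticalChristoffel (l := l) hp Y Z) X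
  have hid := (covariantDeriv_congr (christoffelOp_metric_eventuallyEq hp Y Z)).trans h
  rw [horizontalSecondChristoffel, verticalSecondChristoffel, ← fderiv_horizontalChristoffel hp]
  simpa only [covariantDeriv, fderiv_id, ContinuousLinearMap.id_apply, id_eq] using hid

theorem horizontalSecondChristoffel_sub (hp : p ∈ space m) (X Y Z : Fin 3 → ℝ) :
    horizontalSecondChristoffel m l p X Y Z - horizontalSecondChristoffel m l p Y X Z
      = ((4 * m - 3 * l ^ 2 / 4) / factor m (p 0) (p 1) ^ 2) •
            ((proj Y ⬝ᵥ proj Z) • proj X - (proj X ⬝ᵥ proj Z) • proj Y)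
          + (l ^ 2 / 4 * (form m l p ⬝ᵥ Z)) •
            ((form m l p ⬝ᵥ Y) • proj X - (form m l p ⬝ᵥ X) • proj Y) := by
  have hF : factor m (proj p 0) (proj p 1) ≠ 0 := ne_of_gt hp
  have hbase := baseChristoffel_curvature hF (proj X) (proj Y) (proj Z)
  have htorsion : contactDeriv m l (proj p) (proj X) (proj Y)
      = contactDeriv m l (proj p) (proj Y) (proj X)
        - l * (rot (proj X) ⬝ᵥ proj Y) / factor m (p 0) (p 1) ^ 2 := by
    have h := contactDeriv_sub_contactDeriv (l := l) hF (proj X) (proj Y)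
    rw [factor_proj] at h
    linear_combination h
  have hXYZ := rot_dotProduct_smul_rot (proj X) (proj Y) (proj Z)
  have hYZX := rot_dotProduct_smul_rot (proj Y) (proj Z) (proj X)
  have hXZY := rot_dotProduct_smul_rot (proj X) (proj Z) (proj Y)
  rw [factor_proj] at hbase
  rw [dotProduct_comm (proj Z) (proj X), dotProduct_comm (proj Y) (proj X)] at hYZX
  rw [dotProduct_comm (proj Z) (proj Y)] at hXZY
  simp only [horizontalSecondChristoffel, baseChristoffel_horizontalChristoffel,
    rot_horizontalChristoffel, verticalChristoffel, htorsion,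
    baseChristoffel_comm (proj Y) (proj X)]
  linear_combination (norm := module) hbase
    + (l ^ 2 / (2 * factor m (p 0) (p 1) ^ 2)) • hXYZ
    - (l ^ 2 / (4 * factor m (p 0) (p 1) ^ 2)) • hYZX
    + (l ^ 2 / (4 * factor m (p 0) (p 1) ^ 2)) • hXZY

theorem verticalSecondChristoffel_sub (hp : p ∈ space m) (X Y Z : Fin 3 → ℝ) :
    verticalSecondChristoffel m l p X Y Z - verticalSecondChristoffel m l p Y X Z
      = l ^ 2 / 4 / factor m (p 0) (p 1) ^ 2 *
          ((form m l p ⬝ᵥ X) * (proj Y ⬝ᵥ proj Z) - (form m l p ⬝ᵥ Y) * (proj X ⬝ᵥ proj Z)) := by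
  rw [verticalSecondChristoffel, verticalSecondChristoffel, fderiv_verticalChristoffel hp,
    fderiv_verticalChristoffel hp, dotProduct_comm (proj Y) (proj X)]
  simp only [horizontalChristoffel, baseChristoffel, rot, dotProduct, Fin.sum_univ_two,
    Pi.smul_apply, Pi.sub_apply, Pi.add_apply, smul_eq_mul, Matrix.cons_val_zero,
    Matrix.cons_val_one, Matrix.cons_val_fin_one, factor_proj]
  ring

theorem curvatureOp_metric (hp : p ∈ space m) (X Y Z : Fin 3 → ℝ) :
    curvatureOp (metric m l) p X Y Z
      = horizontalLift m l (proj p)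
          (((4 * m - 3 * l ^ 2 / 4) / factor m (p 0) (p 1) ^ 2) •
              ((proj Y ⬝ᵥ proj Z) • proj X - (proj X ⬝ᵥ proj Z) • proj Y)
            + (l ^ 2 / 4 * (form m l p ⬝ᵥ Z)) •
              ((form m l p ⬝ᵥ Y) • proj X - (form m l p ⬝ᵥ X) • proj Y))
        + (l ^ 2 / 4 / factor m (p 0) (p 1) ^ 2 *
            ((form m l p ⬝ᵥ X) * (proj Y ⬝ᵥ proj Z) - (form m l p ⬝ᵥ Y) * (proj X ⬝ᵥ proj Z)))
          • fiber := by
  have hXY := fderiv_add_christoffelOp_christoffelOp_metric (l := l) hp X Y Z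
  have hYX := fderiv_add_christoffelOp_christoffelOp_metric (l := l) hp Y X Z
  rw [curvatureOp_eq (differentiableAt_christoffelOp_metric hp),
    ← horizontalSecondChristoffel_sub hp, ← verticalSecondChristoffel_sub hp, sub_eq_add_neg
      (horizontalSecondChristoffel m l p X Y Z), horizontalLift_add, ← neg_one_smul ℝ
      (horizontalSecondChristoffel m l p Y X Z), horizontalLift_smul]
  linear_combination (norm := module) hXY - hYX

end Curvature

/-! ### The tension and the bitension field -/

section FrenetFrame

variable {m l : ℝ} {I : Set ℝ} {γ : ℝ → Fin 2 → ℝ} {t : ℝ}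

/-- The geodesic curvature of a curve parametrized by arc length in the base surface. -/
def geodesicCurvature (m : ℝ) (γ : ℝ → Fin 2 → ℝ) (t : ℝ) : ℝ :=
  (rot (deriv γ t) ⬝ᵥ (deriv (deriv γ) t + baseChristoffel m (γ t) (deriv γ t) (deriv γ t)))
    / factor m (γ t 0) (γ t 1) ^ 2

/-- The function `θ` for which `∂ₛ - θ(s) ∂_z` is orthogonal to the fibres of the Hopf cylinder
over `γ`. -/
def tilt (m l : ℝ) (γ : ℝ → Fin 2 → ℝ) (t : ℝ) : ℝ := contact m l (γ t) (deriv γ t)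

namespace IsUnitSpeedCurve

variable (h : IsUnitSpeedCurve m I γ) (ht : t ∈ I)
include h ht

theorem factor_ne_zero : factor m (γ t 0) (γ t 1) ≠ 0 := (h.mem_base t ht).ne'

theorem eventually_mem : ∀ᶠ s in 𝓝 t, s ∈ I := h.isOpen.mem_nhds ht

theorem differentiableAt : DifferentiableAt ℝ γ t :=
  (h.smooth.contDiffAt (h.eventually_mem ht)).differentiableAt (by simp)

omit ht in
theorem contDiffOn_deriv : ContDiffOn ℝ ∞ (deriv γ) I :=
  h.smooth.deriv_of_isOpen h.isOpen (by simp)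

theorem differentiableAt_deriv : DifferentiableAt ℝ (deriv γ) t :=
  (h.contDiffOn_deriv.contDiffAt (h.eventually_mem ht)).differentiableAt (by simp)

theorem deriv_dotProduct_deriv : deriv γ t ⬝ᵥ deriv γ t = factor m (γ t 0) (γ t 1) ^ 2 := by
  have hF := h.factor_ne_zero ht
  have hunit := h.unit_speed t ht
  simp only [baseMetric, Matrix.mulVec_diagonal, dotProduct, Fin.sum_univ_two,
    Matrix.cons_val_zero, Matrix.cons_val_one, Matrix.cons_val_fin_one] at hunit ⊢
  field_simp at hunit
  linear_combination hunit

theorem deriv_ne_zero : deriv γ t ≠ 0 := by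
  rw [Ne, ← dotProduct_self_eq_zero, h.deriv_dotProduct_deriv ht]
  exact pow_ne_zero 2 (h.factor_ne_zero ht)

theorem deriv_deriv_dotProduct_deriv :
    deriv (deriv γ) t ⬝ᵥ deriv γ t
      = 2 * m * factor m (γ t 0) (γ t 1) * (γ t ⬝ᵥ deriv γ t) := by
  have hderiv := hasDerivAt_pi.1 (h.differentiableAt_deriv ht).hasDerivAt
  have hleft : HasDerivAt (fun s => deriv γ s ⬝ᵥ deriv γ s)
      (2 * (deriv (deriv γ) t ⬝ᵥ deriv γ t)) t := by
    simp only [dotProduct, Fin.sum_univ_two]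
    refine (((hderiv 0).fun_mul (hderiv 0)).fun_add ((hderiv 1).fun_mul (hderiv 1))).congr_deriv ?_
    ring
  have hright := (hasDerivAt_factor (m := m) (h.differentiableAt ht).hasDerivAt).fun_pow 2
  have heq := (h.eventually_mem ht).mono fun s hs => h.deriv_dotProduct_deriv hs
  linear_combination (hleft.congr_of_eventuallyEq (EventuallyEq.symm heq)).unique hright / 2

theorem deriv_deriv_add_baseChristoffel :
    deriv (deriv γ) t + baseChristoffel m (γ t) (deriv γ t) (deriv γ t)
      = geodesicCurvature m γ t • rot (deriv γ t) := by
  have hF := h.factor_ne_zero ht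
  have hspeed := h.deriv_dotProduct_deriv ht
  have horthogonal : (deriv (deriv γ) t + baseChristoffel m (γ t) (deriv γ t) (deriv γ t))
      ⬝ᵥ deriv γ t = 0 := by
    simp only [add_dotProduct, h.deriv_deriv_dotProduct_deriv ht, baseChristoffel,
      smul_dotProduct, sub_dotProduct, hspeed, smul_eq_mul]
    field_simp
    ring
  rw [geodesicCurvature, div_eq_inv_mul, mul_smul, rot_dotProduct_smul_rot, horthogonal, hspeed,
    zero_smul, sub_zero, inv_smul_smul₀ (pow_ne_zero 2 hF)]

omit ht in
theorem contDiffOn_geodesicCurvature : ContDiffOn ℝ ∞ (geodesicCurvature m γ) I := by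
  have hγ := contDiffOn_pi.1 h.smooth
  have hγ' := contDiffOn_pi.1 h.contDiffOn_deriv
  have hγ'' := contDiffOn_pi.1 (h.contDiffOn_deriv.deriv_of_isOpen h.isOpen (m := ∞) (by simp))
  have hF : ContDiffOn ℝ ∞ (fun t => factor m (γ t 0) (γ t 1)) I := by
    unfold factor
    fun_prop
  have hF₀ (t) (ht : t ∈ I) := h.factor_ne_zero ht
  unfold geodesicCurvature
  simp only [baseChristoffel, rot, dotProduct, Fin.sum_univ_two, Pi.smul_apply, Pi.add_apply,
    Pi.sub_apply, smul_eq_mul, Matrix.cons_val_zero, Matrix.cons_val_one, Matrix.cons_val_fin_one]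
  fun_prop (disch := simpa using hF₀)

theorem hasDerivAt_geodesicCurvature :
    HasDerivAt (geodesicCurvature m γ) (deriv (geodesicCurvature m γ) t) t :=
  ((h.contDiffOn_geodesicCurvature.contDiffAt (h.eventually_mem ht)).differentiableAt
    (by simp)).hasDerivAt

theorem hasDerivAt_tilt : HasDerivAt (tilt m l γ) (deriv (tilt m l γ) t) t :=
  (differentiableAt_contact (h.differentiableAt ht) (h.differentiableAt_deriv ht)
    (h.factor_ne_zero ht)).hasDerivAt

end IsUnitSpeedCurve

end FrenetFrame

section HopfCylinder

variable {m l : ℝ} {I : Set ℝ} {γ : ℝ → Fin 2 → ℝ} {p : Fin 2 → ℝ} {t : ℝ}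

/-- The vector with components `a`, `b`, `c` in the orthonormal frame along the Hopf cylinder that
consists of the horizontal lifts of the unit tangent and unit normal of `γ` and of `∂_z`. -/
def frameVector (m l : ℝ) (γ : ℝ → Fin 2 → ℝ) (t a b c : ℝ) : Fin 3 → ℝ :=
  horizontalLift m l (γ t) (a • deriv γ t + b • rot (deriv γ t)) + c • fiber

/-- The component of the tension field of the conformal immersion along the horizontal lift of the
unit normal of `γ`, which is the only nonzero one. -/
def normalTension (m : ℝ) (γ : ℝ → Fin 2 → ℝ) (f : (Fin 2 → ℝ) → ℝ) (q : Fin 2 → ℝ) : ℝ :=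
  f q * geodesicCurvature m γ (q 0)

theorem frameVector_add (a b c a' b' c' : ℝ) :
    frameVector m l γ t a b c + frameVector m l γ t a' b' c'
      = frameVector m l γ t (a + a') (b + b') (c + c') := by
  simp only [frameVector, horizontalLift_add, horizontalLift_smul]
  module

theorem frameVector_sub (a b c a' b' c' : ℝ) :
    frameVector m l γ t a b c - frameVector m l γ t a' b' c'
      = frameVector m l γ t (a - a') (b - b') (c - c') := by
  simp only [frameVector, horizontalLift_add, horizontalLift_smul]
  module

theorem smul_frameVector (r a b c : ℝ) :
    r • frameVector m l γ t a b c = frameVector m l γ t (r * a) (r * b) (r * c) := by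
  simp only [frameVector, horizontalLift_add, horizontalLift_smul]
  module

theorem proj_hopfCylinder (γ : ℝ → Fin 2 → ℝ) (p : Fin 2 → ℝ) :
    proj (hopfCylinder γ p) = γ (p 0) := by
  ext i
  fin_cases i <;> rfl

theorem proj_frameVector (a b c : ℝ) :
    proj (frameVector m l γ t a b c) = a • deriv γ t + b • rot (deriv γ t) := by
  rw [frameVector, map_add, map_smul, proj_horizontalLift, proj_fiber, smul_zero, add_zero]

theorem form_frameVector (a b c : ℝ) :
    form m l (hopfCylinder γ p) ⬝ᵥ frameVector m l γ (p 0) a b c = c := by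
  rw [frameVector, ← proj_hopfCylinder γ p, form_horizontalLift_add_smul_fiber]

theorem frameVector_eq_zero (hγ : deriv γ t ≠ 0) {a b c : ℝ}
    (h : frameVector m l γ t a b c = 0) : a = 0 ∧ b = 0 ∧ c = 0 := by
  have hspeed : deriv γ t ⬝ᵥ deriv γ t ≠ 0 := dotProduct_self_eq_zero.not.2 hγ
  have hproj : a • deriv γ t + b • rot (deriv γ t) = 0 := by
    rw [← proj_frameVector (m := m) (l := l) a b c, h, map_zero]
  have ha := congr_arg (deriv γ t ⬝ᵥ ·) hproj
  have hb := congr_arg (rot (deriv γ t) ⬝ᵥ ·) hproj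
  simp only [dotProduct_add, dotProduct_smul, dotProduct_comm (deriv γ t) (rot _),
    rot_dotProduct_self, rot_dotProduct_rot, dotProduct_zero, smul_eq_mul, mul_zero, add_zero,
    zero_add, mul_eq_zero, hspeed, or_false] at ha hb
  refine ⟨ha, hb, ?_⟩
  simpa [frameVector, ha, hb, horizontalLift, contact, fiber] using congr_fun h 2

section AlongCylinder

variable {a b c : (Fin 2 → ℝ) → ℝ}

namespace IsUnitSpeedCurve

variable (h : IsUnitSpeedCurve m I γ) (hp : p 0 ∈ I)
include h hp

theorem hopfCylinder_mem_space : hopfCylinder γ p ∈ space m := h.mem_base _ hp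

theorem hasFDerivAt_hopfCylinder :
    HasFDerivAt (hopfCylinder γ) (ContinuousLinearMap.pi
      ![(ContinuousLinearMap.proj (R := ℝ) (φ := fun _ : Fin 2 => ℝ) 0).smulRight
          (deriv γ (p 0) 0),
        (ContinuousLinearMap.proj (R := ℝ) (φ := fun _ : Fin 2 => ℝ) 0).smulRight
          (deriv γ (p 0) 1),
        ContinuousLinearMap.proj (R := ℝ) (φ := fun _ : Fin 2 => ℝ) 1]) p := by
  have hγ := hasDerivAt_pi.1 (h.differentiableAt hp).hasDerivAt
  refine hasFDerivAt_pi.2 fun i => ?_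
  fin_cases i
  exacts [hasFDerivAt_comp_zero (hγ 0), hasFDerivAt_comp_zero (hγ 1), hasFDerivAt_apply 1 p]

theorem fderiv_hopfCylinder (X : Fin 2 → ℝ) :
    fderiv ℝ (hopfCylinder γ) p X
      = frameVector m l γ (p 0) (X 0) 0 (tilt m l γ (p 0) * X 0 + X 1) := by
  rw [(h.hasFDerivAt_hopfCylinder hp).fderiv, frameVector, horizontalLift_add_smul_fiber]
  ext i
  fin_cases i <;> simp [tilt, contact]
  ring

theorem smul_pullbackMetric_hopfCylinder (f : (Fin 2 → ℝ) → ℝ) :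
    (f p)⁻¹ • pullbackMetric (metric m l) (hopfCylinder γ) p
      = shearMetric (tilt m l γ) f p := by
  have hF := h.factor_ne_zero hp
  have hpullback (X Y : Fin 2 → ℝ) :
      fderiv ℝ (hopfCylinder γ) p X
          ⬝ᵥ metric m l (hopfCylinder γ p) *ᵥ fderiv ℝ (hopfCylinder γ) p Y
        = X 0 * Y 0
          + (tilt m l γ (p 0) * X 0 + X 1) * (tilt m l γ (p 0) * Y 0 + Y 1) := by
    rw [dotProduct_metric, h.fderiv_hopfCylinder (l := l) hp, h.fderiv_hopfCylinder (l := l) hp,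
      form_frameVector, form_frameVector, proj_frameVector, proj_frameVector, zero_smul, add_zero,
      add_zero, smul_dotProduct, dotProduct_smul, h.deriv_dotProduct_deriv hp,
      ← factor_proj, proj_hopfCylinder]
    simp only [smul_eq_mul]
    field_simp
  rw [shearMetric]
  congr 1
  ext i j
  rw [pullbackMetric, Matrix.of_apply, partialD, partialD, hpullback]
  fin_cases i <;> fin_cases j <;> simp [sq]

theorem differentiableAt_frameVector (ha : DifferentiableAt ℝ a p)
    (hb : DifferentiableAt ℝ b p) (hc : DifferentiableAt ℝ c p) :
    DifferentiableAt ℝ (fun q => frameVector m l γ (q 0) (a q) (b q) (c q)) p := by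
  have hT := (h.differentiableAt_deriv hp).hasDerivAt
  exact differentiableAt_horizontalLift_add_smul_fiber
    (hasFDerivAt_comp_zero (h.differentiableAt hp).hasDerivAt).differentiableAt
    (h.factor_ne_zero hp)
    ((ha.fun_smul (hasFDerivAt_comp_zero hT).differentiableAt).fun_add
      (hb.fun_smul (hasFDerivAt_comp_zero (hasDerivAt_rot hT)).differentiableAt)) hc

theorem covariantDeriv_frameVector (ha : DifferentiableAt ℝ a p)
    (hb : DifferentiableAt ℝ b p) (hc : DifferentiableAt ℝ c p) (X : Fin 2 → ℝ) :
    covariantDeriv (metric m l) (hopfCylinder γ) X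
        (fun q => frameVector m l γ (q 0) (a q) (b q) (c q)) p
      = frameVector m l γ (p 0)
          (fderiv ℝ a p X - X 0 * geodesicCurvature m γ (p 0) * b p
            + l / 2 * (tilt m l γ (p 0) * X 0 + X 1) * b p)
          (fderiv ℝ b p X + X 0 * geodesicCurvature m γ (p 0) * a p
            - l / 2 * ((tilt m l γ (p 0) * X 0 + X 1) * a p + X 0 * c p))
          (fderiv ℝ c p X + l / 2 * X 0 * b p) := by
  have hT := (h.differentiableAt_deriv hp).hasDerivAt
  have hhor := (ha.hasFDerivAt.fun_smul (hasFDerivAt_comp_zero hT)).fun_add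
    (hb.hasFDerivAt.fun_smul (hasFDerivAt_comp_zero (hasDerivAt_rot hT)))
  have hfrenet := h.deriv_deriv_add_baseChristoffel hp
  have hfrenet' := congr_arg rot hfrenet
  have hcov := covariantDeriv_horizontalLift_add_smul_fiber (l := l)
    (h.hasFDerivAt_hopfCylinder hp).differentiableAt (h.hopfCylinder_mem_space hp)
    hhor.differentiableAt hc X
  rw [rot_add, rot_smul, rot_rot] at hfrenet'
  simp only [proj_hopfCylinder] at hcov
  refine hcov.trans ?_
  rw [hhor.fderiv, h.fderiv_hopfCylinder (l := l) hp, form_frameVector, proj_frameVector]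
  rw [frameVector]
  congr 2
  · simp only [_root_.add_apply, _root_.smul_apply, ContinuousLinearMap.smulRight_apply,
      ContinuousLinearMap.proj_apply, zero_smul, add_zero, rot_add, rot_smul, rot_rot,
      baseChristoffel_comm (X 0 • _), baseChristoffel_smul_right]
    rw [baseChristoffel_comm, baseChristoffel_add_right, baseChristoffel_smul_right,
      baseChristoffel_smul_right, baseChristoffel_rot_right]
    linear_combination (norm := module) (a p * X 0) • hfrenet + (b p * X 0) • hfrenet'
  · rw [zero_smul, add_zero, rot_smul, smul_dotProduct, dotProduct_add, dotProduct_smul,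
      dotProduct_smul, rot_dotProduct_self, rot_dotProduct_rot, h.deriv_dotProduct_deriv hp,
      ← factor_proj, proj_hopfCylinder]
    simp only [smul_eq_mul]
    have hF := h.factor_ne_zero hp
    field_simp
    ring

theorem curvatureOp_frameVector (u a₁ c₁ a₂ c₂ : ℝ) :
    curvatureOp (metric m l) (hopfCylinder γ p) (frameVector m l γ (p 0) a₁ 0 c₁)
        (frameVector m l γ (p 0) 0 u 0) (frameVector m l γ (p 0) a₂ 0 c₂)
      = frameVector m l γ (p 0) 0
          (-(u * ((4 * m - 3 * l ^ 2 / 4) * (a₁ * a₂) + l ^ 2 / 4 * (c₁ * c₂)))) 0 := by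
  have hF := h.factor_ne_zero hp
  have hspeed := h.deriv_dotProduct_deriv hp
  rw [curvatureOp_metric (h.hopfCylinder_mem_space hp), form_frameVector, form_frameVector,
    form_frameVector, proj_frameVector, proj_frameVector, proj_frameVector, proj_hopfCylinder,
    ← factor_proj, proj_hopfCylinder]
  simp only [zero_smul, add_zero, zero_add, smul_dotProduct, dotProduct_smul, rot_dotProduct_self,
    hspeed, smul_eq_mul, mul_zero, zero_mul, sub_self, zero_sub, frameVector]
  congr 2
  match_scalars
  field_simp
  ring

theorem partialD_zero_hopfCylinder :
    partialD 0 (hopfCylinder γ) p = frameVector m l γ (p 0) 1 0 (tilt m l γ (p 0)) := by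
  simp [partialD, h.fderiv_hopfCylinder (l := l) hp]

theorem partialD_one_hopfCylinder :
    partialD 1 (hopfCylinder γ) p = frameVector m l γ (p 0) 0 0 1 := by
  simp [partialD, h.fderiv_hopfCylinder (l := l) hp]

theorem partialD_hopfCylinder_shearField :
    partialD 0 (hopfCylinder γ) p + (-tilt m l γ (p 0)) • partialD 1 (hopfCylinder γ) p
      = frameVector m l γ (p 0) 1 0 0 := by
  rw [h.partialD_zero_hopfCylinder (l := l) hp, h.partialD_one_hopfCylinder (l := l) hp,
    smul_frameVector, frameVector_add]
  simp

theorem eventually_zero_mem : ∀ᶠ q in 𝓝 p, q 0 ∈ I :=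
  (continuous_apply 0).continuousAt.eventually (h.eventually_mem hp)

theorem differentiableAt_partialD_hopfCylinder (j : Fin 2) :
    DifferentiableAt ℝ (partialD j (hopfCylinder γ)) p := by
  have hnear := h.eventually_zero_mem hp
  fin_cases j
  · exact (h.differentiableAt_frameVector (l := 0) hp (differentiableAt_const 1)
      (differentiableAt_const 0)
      (hasFDerivAt_comp_zero (h.hasDerivAt_tilt hp)).differentiableAt).congr_of_eventuallyEq
      (hnear.mono fun q hq => h.partialD_zero_hopfCylinder hq)
  · exact (h.differentiableAt_frameVector (l := 0) hp (differentiableAt_const 0)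
      (differentiableAt_const 0) (differentiableAt_const 1)).congr_of_eventuallyEq
      (hnear.mono fun q hq => h.partialD_one_hopfCylinder hq)

theorem tension_hopfCylinder {f : (Fin 2 → ℝ) → ℝ} (hf : DifferentiableAt ℝ f p)
    (hf₀ : f p ≠ 0) :
    tension (shearMetric (tilt m l γ) f) (metric m l) (hopfCylinder γ) p
      = frameVector m l γ (p 0) 0 (normalTension m γ f p) 0 := by
  have hnear := h.eventually_zero_mem hp
  have hshear : (fun q => partialD 0 (hopfCylinder γ) q
        + (-tilt m l γ (q 0)) • partialD 1 (hopfCylinder γ) q)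
      =ᶠ[𝓝 p] fun q => frameVector m l γ (q 0) 1 0 0 :=
    hnear.mono fun q hq => h.partialD_hopfCylinder_shearField hq
  have hfiber : partialD 1 (hopfCylinder γ) =ᶠ[𝓝 p] fun q => frameVector m l γ (q 0) 0 0 1 :=
    hnear.mono fun q hq => h.partialD_one_hopfCylinder hq
  rw [tension, trace_pullbackD_shearMetric (P := fun j => partialD j (hopfCylinder γ))
    (h.hasDerivAt_tilt hp) hf hf₀ (h.differentiableAt_partialD_hopfCylinder hp),
    covariantDeriv_congr hshear, covariantDeriv_congr hfiber,
    h.covariantDeriv_frameVector hp (differentiableAt_const 1) (differentiableAt_const 0)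
      (differentiableAt_const 0),
    h.covariantDeriv_frameVector hp (differentiableAt_const 0) (differentiableAt_const 0)
      (differentiableAt_const 1), frameVector_add, smul_frameVector]
  simp [shearField, normalTension]

end IsUnitSpeedCurve

end AlongCylinder

end HopfCylinder

section Bitension

variable {m l : ℝ} {I : Set ℝ} {γ : ℝ → Fin 2 → ℝ} {p : Fin 2 → ℝ} {U : Set (Fin 2 → ℝ)}
  {f : (Fin 2 → ℝ) → ℝ}

namespace IsUnitSpeedCurve

theorem trace_curvatureOp_hopfCylinder (h : IsUnitSpeedCurve m I γ) (hp : p 0 ∈ I)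
    (hf₀ : f p ≠ 0) (v : ℝ) :
    ∑ i, ∑ j, (shearMetric (tilt m l γ) f p)⁻¹ i j •
        curvatureOp (metric m l) (hopfCylinder γ p) (partialD i (hopfCylinder γ) p)
          (frameVector m l γ (p 0) 0 v 0) (partialD j (hopfCylinder γ) p)
      = f p • frameVector m l γ (p 0) 0 (-(v * (4 * m - l ^ 2 / 2))) 0 := by
  rw [trace_shearMetric hf₀]
  simp only [h.partialD_zero_hopfCylinder (l := l) hp, h.partialD_one_hopfCylinder (l := l) hp,
    h.curvatureOp_frameVector hp, smul_frameVector, frameVector_add, frameVector_sub]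
  ring_nf

variable (h : IsUnitSpeedCurve m I γ) (hU : IsOpen U) (hUI : ∀ q ∈ U, q 0 ∈ I)
  (hf : ContDiffOn ℝ ∞ f U)
include h hUI hf

theorem contDiffOn_normalTension : ContDiffOn ℝ ∞ (normalTension m γ f) U :=
  hf.mul (h.contDiffOn_geodesicCurvature.comp (by fun_prop) hUI)

variable (hp : p ∈ U)
include hU hp

theorem covariantDeriv_tension (hf₀ : ∀ q ∈ U, f q ≠ 0) (X : Fin 2 → ℝ) :
    covariantDeriv (metric m l) (hopfCylinder γ) X
        (tension (shearMetric (tilt m l γ) f) (metric m l) (hopfCylinder γ)) p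
      = frameVector m l γ (p 0)
          ((l / 2 * (tilt m l γ (p 0) * X 0 + X 1) - X 0 * geodesicCurvature m γ (p 0))
            * normalTension m γ f p)
          (fderiv ℝ (normalTension m γ f) p X)
          (l / 2 * X 0 * normalTension m γ f p) := by
  have hu := differentiableAt_of_contDiffOn hU (h.contDiffOn_normalTension hUI hf) hp
  have hτ : tension (shearMetric (tilt m l γ) f) (metric m l) (hopfCylinder γ)
      =ᶠ[𝓝 p] fun q => frameVector m l γ (q 0) 0 (normalTension m γ f q) 0 :=
    (hU.eventually_mem hp).mono fun q hq =>
      h.tension_hopfCylinder (hUI q hq) (differentiableAt_of_contDiffOn hU hf hq) (hf₀ q hq)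
  rw [covariantDeriv_congr hτ, h.covariantDeriv_frameVector (hUI p hp) (differentiableAt_const 0)
    hu (differentiableAt_const 0)]
  simp only [fderiv_fun_const, Pi.zero_apply, _root_.zero_apply, mul_zero, add_zero, sub_zero,
    zero_add, zero_sub]
  ring_nf

theorem differentiableAt_covariantDeriv_tension (hf₀ : ∀ q ∈ U, f q ≠ 0) (X : Fin 2 → ℝ) :
    DifferentiableAt ℝ (fun q => covariantDeriv (metric m l) (hopfCylinder γ) X
      (tension (shearMetric (tilt m l γ) f) (metric m l) (hopfCylinder γ)) q) p := by
  have hu := h.contDiffOn_normalTension hUI hf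
  have hu' := (hu.fderiv_of_isOpen hU (m := ∞) (by simp)).clm_apply (contDiffOn_const (c := X))
  have hdu := differentiableAt_of_contDiffOn hU hu hp
  have hκ := (hasFDerivAt_comp_zero (h.hasDerivAt_geodesicCurvature (hUI p hp))).differentiableAt
  have hθ := (hasFDerivAt_comp_zero (h.hasDerivAt_tilt (l := l) (hUI p hp))).differentiableAt
  refine DifferentiableAt.congr_of_eventuallyEq ?_ ((hU.eventually_mem hp).mono fun q hq =>
    h.covariantDeriv_tension hU hUI hf hq hf₀ X)
  exact h.differentiableAt_frameVector (hUI p hp) (by fun_prop)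
    (differentiableAt_of_contDiffOn hU hu' hp) (by fun_prop)

theorem pullbackD_shearField_tension (hf₀ : ∀ q ∈ U, f q ≠ 0) :
    pullbackD (metric m l) (hopfCylinder γ) 0
          (tension (shearMetric (tilt m l γ) f) (metric m l) (hopfCylinder γ)) p
        + (-tilt m l γ (p 0)) • pullbackD (metric m l) (hopfCylinder γ) 1
          (tension (shearMetric (tilt m l γ) f) (metric m l) (hopfCylinder γ)) p
      = frameVector m l γ (p 0)
          (-(geodesicCurvature m γ (p 0) * normalTension m γ f p))
          (shearDeriv (tilt m l γ) (normalTension m γ f) p)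
          (l / 2 * normalTension m γ f p) := by
  have hcov := h.covariantDeriv_tension (l := l) hU hUI hf hp hf₀ (shearField (tilt m l γ) p)
  rw [shearField_eq, covariantDeriv_add_direction, covariantDeriv_smul_direction,
    ← shearField_eq] at hcov
  refine hcov.trans ?_
  simp [shearField, shearDeriv]

theorem pullbackD_one_tension (hf₀ : ∀ q ∈ U, f q ≠ 0) :
    pullbackD (metric m l) (hopfCylinder γ) 1
        (tension (shearMetric (tilt m l γ) f) (metric m l) (hopfCylinder γ)) p
      = frameVector m l γ (p 0) (l / 2 * normalTension m γ f p)
          (partialD 1 (normalTension m γ f) p) 0 := by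
  refine (h.covariantDeriv_tension (l := l) hU hUI hf hp hf₀ (Pi.single 1 1)).trans ?_
  simp [partialD]

theorem trace_pullbackD_tension (hf₀ : ∀ q ∈ U, f q ≠ 0) :
    ∑ i, ∑ j, (shearMetric (tilt m l γ) f p)⁻¹ i j •
        (pullbackD (metric m l) (hopfCylinder γ) i (pullbackD (metric m l) (hopfCylinder γ) j
            (tension (shearMetric (tilt m l γ) f) (metric m l) (hopfCylinder γ))) p
          - ∑ r, christoffel (shearMetric (tilt m l γ) f) r i j p •
            pullbackD (metric m l) (hopfCylinder γ) r
              (tension (shearMetric (tilt m l γ) f) (metric m l) (hopfCylinder γ)) p)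
      = f p • frameVector m l γ (p 0)
          (l * partialD 1 (normalTension m γ f) p
            - deriv (geodesicCurvature m γ) (p 0) * normalTension m γ f p
            - 2 * geodesicCurvature m γ (p 0)
              * shearDeriv (tilt m l γ) (normalTension m γ f) p)
          (shearDeriv (tilt m l γ) (shearDeriv (tilt m l γ) (normalTension m γ f)) p
            + partialD 1 (partialD 1 (normalTension m γ f)) p
            - normalTension m γ f p * (geodesicCurvature m γ (p 0) ^ 2 + l ^ 2 / 2))
          (l * shearDeriv (tilt m l γ) (normalTension m γ f) p) := by
  have hpI := hUI p hp
  have hu := h.contDiffOn_normalTension hUI hf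
  have hdu := differentiableAt_of_contDiffOn hU hu hp
  have hduz := differentiableAt_of_contDiffOn hU (contDiffOn_partialD hU hu 1) hp
  have hκ := hasFDerivAt_comp_zero (h.hasDerivAt_geodesicCurvature hpI)
  have hθ := h.hasDerivAt_tilt (l := l) hpI
  have hκu := hκ.fun_mul hdu.hasFDerivAt
  have hnear := hU.eventually_mem hp
  rw [trace_pullbackD_shearMetric (P := fun j => pullbackD (metric m l) (hopfCylinder γ) j
        (tension (shearMetric (tilt m l γ) f) (metric m l) (hopfCylinder γ)))
      hθ (differentiableAt_of_contDiffOn hU hf hp) (hf₀ p hp)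
      fun j => h.differentiableAt_covariantDeriv_tension hU hUI hf hp hf₀ (Pi.single j 1),
    covariantDeriv_congr (hnear.mono fun q hq => h.pullbackD_shearField_tension hU hUI hf hq hf₀),
    covariantDeriv_congr (hnear.mono fun q hq => h.pullbackD_one_tension hU hUI hf hq hf₀),
    h.covariantDeriv_frameVector hpI hκu.differentiableAt.fun_neg
      (differentiableAt_shearDeriv hU hu hp hθ) (hdu.const_mul _),
    h.covariantDeriv_frameVector hpI (hdu.const_mul _) hduz (differentiableAt_const 0),
    frameVector_add, fderiv_fun_neg, hκu.fderiv, fderiv_const_mul hdu]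
  simp only [shearDeriv, partialD, shearField, Matrix.cons_val_zero, Matrix.cons_val_one,
    Matrix.cons_val_fin_one]
  congr 2 <;> simp <;> ring

theorem bitension_hopfCylinder (hf₀ : ∀ q ∈ U, f q ≠ 0) :
    bitension (shearMetric (tilt m l γ) f) (metric m l) (hopfCylinder γ) p
      = f p • frameVector m l γ (p 0)
          (l * partialD 1 (normalTension m γ f) p
            - deriv (geodesicCurvature m γ) (p 0) * normalTension m γ f p
            - 2 * geodesicCurvature m γ (p 0)
              * shearDeriv (tilt m l γ) (normalTension m γ f) p)
          (shearDeriv (tilt m l γ) (shearDeriv (tilt m l γ) (normalTension m γ f)) p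
            + partialD 1 (partialD 1 (normalTension m γ f)) p
            - normalTension m γ f p * (geodesicCurvature m γ (p 0) ^ 2 + (l ^ 2 - 4 * m)))
          (l * shearDeriv (tilt m l γ) (normalTension m γ f) p) := by
  have hfp := differentiableAt_of_contDiffOn hU hf hp
  simp only [bitension, smul_sub (_ : ℝ) (_ - _), Finset.sum_sub_distrib]
  rw [h.trace_pullbackD_tension hU hUI hf hp hf₀,
    h.tension_hopfCylinder (hUI p hp) hfp (hf₀ p hp),
    h.trace_curvatureOp_hopfCylinder (hUI p hp) (hf₀ p hp), ← smul_sub, frameVector_sub]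
  congr 2 <;> ring

end IsUnitSpeedCurve

end Bitension

/-! ### The biharmonic equations -/

section BiharmonicEquations

variable {θ κ κ' : ℝ → ℝ} {A : Set (Fin 2 → ℝ)} {u : (Fin 2 → ℝ) → ℝ} {l μ : ℝ} {p : Fin 2 → ℝ}

theorem deriv_eq_zero_of_mul_partialD_one_eq (hA : IsOpen A) (hu : ContDiffOn ℝ ∞ u A)
    (hθ : ∀ q ∈ A, DifferentiableAt ℝ θ (q 0)) (hκ' : ∀ q ∈ A, DifferentiableAt ℝ κ' (q 0))
    (htangent : ∀ q ∈ A, l * partialD 1 u q = κ' (q 0) * u q)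
    (hfiber : ∀ q ∈ A, shearDeriv θ u q = 0) (hp : p ∈ A) (hup : u p ≠ 0) :
    deriv κ' (p 0) = 0 := by
  have hdu := differentiableAt_of_contDiffOn hA hu hp
  have hduz := differentiableAt_of_contDiffOn hA (contDiffOn_partialD hA hu 1) hp
  have hcomm : shearDeriv θ (partialD 1 u) p = 0 := by
    have hzero : shearDeriv θ u =ᶠ[𝓝 p] fun _ => 0 := (hA.eventually_mem hp).mono hfiber
    rw [← partialD_one_shearDeriv hA hu hp (hθ p hp).hasDerivAt, partialD_congr hzero]
    simp [partialD]
  have hderiv : fderiv ℝ (fun q => l * partialD 1 u q) p (shearField θ p)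
      = fderiv ℝ (fun q => κ' (q 0) * u q) p (shearField θ p) := by
    rw [EventuallyEq.fderiv_eq ((hA.eventually_mem hp).mono htangent)]
  have hEu := hfiber p hp
  rw [fderiv_const_mul hduz, ((hasFDerivAt_comp_zero (hκ' p hp).hasDerivAt).fun_mul
    hdu.hasFDerivAt).fderiv] at hderiv
  unfold shearDeriv at hcomm hEu
  simpa [hcomm, hEu, shearField_zero, hup] using hderiv.symm

theorem sq_eq_of_shearDeriv_eq_zero (hA : IsOpen A) (hu : ContDiffOn ℝ ∞ u A)
    (htangent : ∀ q ∈ A, l * partialD 1 u q = κ' (q 0) * u q)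
    (hfiber : ∀ q ∈ A, shearDeriv θ u q = 0)
    (hκ' : DifferentiableAt ℝ κ' (p 0))
    (hnormal : shearDeriv θ (shearDeriv θ u) p + partialD 1 (partialD 1 u) p
      = u p * (κ (p 0) ^ 2 + μ))
    (hp : p ∈ A) (hup : u p ≠ 0) :
    κ' (p 0) ^ 2 = l ^ 2 * (κ (p 0) ^ 2 + μ) := by
  have hdu := differentiableAt_of_contDiffOn hA hu hp
  have hduz := differentiableAt_of_contDiffOn hA (contDiffOn_partialD hA hu 1) hp
  have hEE : shearDeriv θ (shearDeriv θ u) p = 0 := by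
    have hzero : shearDeriv θ u =ᶠ[𝓝 p] fun _ => 0 := (hA.eventually_mem hp).mono hfiber
    rw [shearDeriv, hzero.fderiv_eq]
    simp
  have hzz : l * partialD 1 (partialD 1 u) p = κ' (p 0) * partialD 1 u p := by
    have hderiv : partialD 1 (fun q => l * partialD 1 u q) p
        = partialD 1 (fun q => κ' (q 0) * u q) p :=
      partialD_congr ((hA.eventually_mem hp).mono htangent) 1
    rw [partialD, fderiv_const_mul hduz, partialD,
      ((hasFDerivAt_comp_zero hκ'.hasDerivAt).fun_mul hdu.hasFDerivAt).fderiv] at hderiv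
    simpa [partialD] using hderiv
  refine mul_left_cancel₀ hup ?_
  linear_combination l ^ 2 * hnormal - l ^ 2 * hEE - l * hzz - κ' (p 0) * htangent p hp

theorem eq_zero_of_shearDeriv_eq_zero (hl : l ≠ 0) (hA : IsOpen A) (hu : ContDiffOn ℝ ∞ u A)
    (hθ : ∀ q ∈ A, DifferentiableAt ℝ θ (q 0))
    (hκ : HasDerivAt κ (κ' (p 0)) (p 0)) (hκ' : ∀ q ∈ A, DifferentiableAt ℝ κ' (q 0))
    (hκ₀ : κ (p 0) ≠ 0) (hu₀ : ∀ q ∈ A, u q ≠ 0)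
    (htangent : ∀ q ∈ A, l * partialD 1 u q = κ' (q 0) * u q)
    (hnormal : ∀ q ∈ A, shearDeriv θ (shearDeriv θ u) q + partialD 1 (partialD 1 u) q
      = u q * (κ (q 0) ^ 2 + μ))
    (hfiber : ∀ q ∈ A, shearDeriv θ u q = 0) (hp : p ∈ A) : κ' (p 0) = 0 := by
  have hκ'' : deriv κ' (p 0) = 0 :=
    deriv_eq_zero_of_mul_partialD_one_eq hA hu hθ hκ' htangent hfiber hp (hu₀ p hp)
  have hsq : (fun q => κ' (q 0) ^ 2) =ᶠ[𝓝 p] fun q => l ^ 2 * (κ (q 0) ^ 2 + μ) :=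
    (hA.eventually_mem hp).mono fun q hq =>
      sq_eq_of_shearDeriv_eq_zero hA hu htangent hfiber (hκ' q hq) (hnormal q hq) hq (hu₀ q hq)
  have hderiv : HasFDerivAt (fun q => κ' (q 0) ^ 2) _ p :=
    hasFDerivAt_comp_zero ((hκ' p hp).hasDerivAt.fun_pow 2)
  have hderiv' : HasFDerivAt (fun q => l ^ 2 * (κ (q 0) ^ 2 + μ)) _ p :=
    hasFDerivAt_comp_zero (((hκ.fun_pow 2).add_const μ).const_mul (l ^ 2))
  have h := DFunLike.congr_fun
    ((hderiv.congr_of_eventuallyEq hsq.symm).unique hderiv') (Pi.single 0 1)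
  simpa [hκ'', hl, hκ₀] using h.symm

end BiharmonicEquations

namespace IsProperBiharmonicHopf

variable {m l : ℝ} {I : Set ℝ} {γ : ℝ → Fin 2 → ℝ} {U : Set (Fin 2 → ℝ)} {f : (Fin 2 → ℝ) → ℝ}
  {p : Fin 2 → ℝ} (H : IsProperBiharmonicHopf m l I γ U f)
include H

theorem contDiffOn_normalTension : ContDiffOn ℝ ∞ (normalTension m γ f) U :=
  H.curve.contDiffOn_normalTension H.subset H.smooth

theorem differentiableAt_normalTension (hp : p ∈ U) :
    DifferentiableAt ℝ (normalTension m γ f) p :=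
  differentiableAt_of_contDiffOn H.isOpen H.contDiffOn_normalTension hp

theorem metric_eventuallyEq (hp : p ∈ U) :
    (fun q => (f q)⁻¹ • pullbackMetric (metric m l) (hopfCylinder γ) q)
      =ᶠ[𝓝 p] shearMetric (tilt m l γ) f :=
  (H.isOpen.eventually_mem hp).mono fun _ hq =>
    H.curve.smul_pullbackMetric_hopfCylinder (H.subset hq) f

theorem exists_normalTension_ne_zero : ∃ p ∈ U, normalTension m γ f p ≠ 0 := by
  by_contra! hzero
  refine H.properBiharmonic.2 fun p hp => ?_
  rw [tension_congr (H.metric_eventuallyEq hp), H.curve.tension_hopfCylinder (H.subset hp)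
    (differentiableAt_of_contDiffOn H.isOpen H.smooth hp) (H.pos p hp).ne', hzero p hp]
  simp [frameVector, horizontalLift, contact]

theorem normalTension_equations (hp : p ∈ U) :
    l * partialD 1 (normalTension m γ f) p
        - deriv (geodesicCurvature m γ) (p 0) * normalTension m γ f p
        - 2 * geodesicCurvature m γ (p 0)
          * shearDeriv (tilt m l γ) (normalTension m γ f) p = 0 ∧
      shearDeriv (tilt m l γ) (shearDeriv (tilt m l γ) (normalTension m γ f)) p
        + partialD 1 (partialD 1 (normalTension m γ f)) p
        - normalTension m γ f p * (geodesicCurvature m γ (p 0) ^ 2 + (l ^ 2 - 4 * m)) = 0 ∧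
      l * shearDeriv (tilt m l γ) (normalTension m γ f) p = 0 := by
  have hbitension := H.properBiharmonic.1 p hp
  rw [bitension_congr (H.metric_eventuallyEq hp), H.curve.bitension_hopfCylinder H.isOpen
    H.subset H.smooth hp fun q hq => (H.pos q hq).ne'] at hbitension
  exact frameVector_eq_zero (H.curve.deriv_ne_zero (H.subset hp))
    ((smul_eq_zero.1 hbitension).resolve_left (H.pos p hp).ne')

variable (hl : l ≠ 0) (hp : p ∈ U)
include hl hp

theorem shearDeriv_normalTension :
    shearDeriv (tilt m l γ) (normalTension m γ f) p = 0 :=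
  (mul_eq_zero.1 (H.normalTension_equations hp).2.2).resolve_left hl

theorem mul_partialD_one_normalTension :
    l * partialD 1 (normalTension m γ f) p
      = deriv (geodesicCurvature m γ) (p 0) * normalTension m γ f p := by
  have htangent := (H.normalTension_equations hp).1
  rw [H.shearDeriv_normalTension hl hp] at htangent
  linear_combination htangent

theorem deriv_geodesicCurvature_eq_zero (hup : normalTension m γ f p ≠ 0) :
    deriv (geodesicCurvature m γ) (p 0) = 0 := by
  have hA : IsOpen (U ∩ {q | normalTension m γ f q ≠ 0}) :=
    H.contDiffOn_normalTension.continuousOn.isOpen_inter_preimage H.isOpen isOpen_ne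
  refine eq_zero_of_shearDeriv_eq_zero (μ := l ^ 2 - 4 * m) hl hA
    (H.contDiffOn_normalTension.mono Set.inter_subset_left)
    (fun q hq => (H.curve.hasDerivAt_tilt (H.subset hq.1)).differentiableAt)
    (H.curve.hasDerivAt_geodesicCurvature (H.subset hp))
    (fun q hq => differentiableAt_of_contDiffOn H.curve.isOpen
      (H.curve.contDiffOn_geodesicCurvature.deriv_of_isOpen H.curve.isOpen (by simp))
      (H.subset hq.1))
    (right_ne_zero_of_mul hup) (fun q hq => hq.2)
    (fun q hq => H.mul_partialD_one_normalTension hl hq.1)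
    (fun q hq => sub_eq_zero.1 (H.normalTension_equations hq.1).2.1)
    (fun q hq => H.shearDeriv_normalTension hl hq.1) ⟨hp, hup⟩

theorem fderiv_normalTension_eq_zero (hup : normalTension m γ f p ≠ 0) :
    fderiv ℝ (normalTension m γ f) p = 0 := by
  have hz := H.mul_partialD_one_normalTension hl hp
  rw [H.deriv_geodesicCurvature_eq_zero hl hp hup, zero_mul] at hz
  have hz' := (mul_eq_zero.1 hz).resolve_left hl
  have hE := H.shearDeriv_normalTension hl hp
  rw [shearDeriv, shearField_eq, map_add, map_smul] at hE
  refine ContinuousLinearMap.coe_injective ((Pi.basisFun ℝ (Fin 2)).ext fun i => ?_)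
  unfold partialD at hz'
  rw [hz', smul_zero, add_zero] at hE
  fin_cases i <;> simpa

omit hp in
theorem normalTension_ne_zero : ∀ q ∈ U, normalTension m γ f q ≠ 0 := by
  have hdiff (q) (hq : q ∈ U) := H.differentiableAt_normalTension hq
  obtain ⟨a, ha⟩ : ∃ a, ∀ q ∈ U, normalTension m γ f q ^ 2 = a := by
    refine H.isOpen.exists_is_const_of_fderiv_eq_zero H.isConnected.isPreconnected
      (fun q hq => ((hdiff q hq).fun_pow 2).differentiableWithinAt) fun q hq => ?_
    rw [fderiv_fun_pow 2 (hdiff q hq)]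
    by_cases huq : normalTension m γ f q = 0
    · simp [huq]
    · simp [H.fderiv_normalTension_eq_zero hl hq huq]
  obtain ⟨r, hr, hur⟩ := H.exists_normalTension_ne_zero
  intro q hq huq
  have hsq := (ha r hr).trans (ha q hq).symm
  rw [huq] at hsq
  simp [hur] at hsq

theorem fderiv_eq_zero : fderiv ℝ f p = 0 := by
  have hup := H.normalTension_ne_zero hl p hp
  have hf := differentiableAt_of_contDiffOn H.isOpen H.smooth hp
  have hκ := hasFDerivAt_comp_zero (H.curve.hasDerivAt_geodesicCurvature (H.subset hp))
  have hderiv : fderiv ℝ (normalTension m γ f) p = _ := (hf.hasFDerivAt.fun_mul hκ).fderiv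
  rw [H.fderiv_normalTension_eq_zero hl hp hup, H.deriv_geodesicCurvature_eq_zero hl hp hup,
    ContinuousLinearMap.smulRight_zero, smul_zero, zero_add] at hderiv
  exact (smul_eq_zero.1 hderiv.symm).resolve_left (right_ne_zero_of_mul hup)

omit hl hp in
theorem eq_zero : l = 0 := by
  by_contra hl
  obtain ⟨b, hb⟩ := H.isOpen.exists_is_const_of_fderiv_eq_zero H.isConnected.isPreconnected
    (H.smooth.differentiableOn (by simp)) fun q hq => H.fderiv_eq_zero hl hq
  exact H.nonconstant ⟨√b, fun q hq => by rw [hb q hq]⟩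

end IsProperBiharmonicHopf

theorem metric_zero_right (m : ℝ) (p : Fin 3 → ℝ) : metric m 0 p = productMetric (4 * m) p := by
  ext i j
  fin_cases i <;> fin_cases j <;> simp [metric, productMetric, form, factor]

theorem space_eq (m : ℝ) : space m = {p | 0 < 1 + 4 * m / 4 * (p 0 ^ 2 + p 1 ^ 2)} := by
  simp [space, factor]

theorem isSphereTimesLine_or_isHyperbolicPlaneTimesLine_or_isEuclidean (m : ℝ) :
    IsSphereTimesLine m 0 ∨ IsHyperbolicPlaneTimesLine m 0 ∨ IsEuclidean m 0 := by
  rcases lt_trichotomy m 0 with hm | rfl | hm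
  · exact .inr (.inl ⟨4 * m, by linarith, space_eq m, fun p _ => metric_zero_right m p⟩)
  · refine .inr (.inr ⟨by simp [space, factor], fun p => ?_⟩)
    rw [metric_zero_right]
    ext i j
    fin_cases i <;> fin_cases j <;> simp [productMetric]
  · exact .inl ⟨4 * m, by linarith, space_eq m, fun p _ => metric_zero_right m p⟩

end BCV

end

theorem mainTheorem6 (m l : ℝ) :
    ((∃ (I : Set ℝ) (γ : ℝ → Fin 2 → ℝ) (U : Set (Fin 2 → ℝ)) (f : (Fin 2 → ℝ) → ℝ),
        BCV.IsProperBiharmonicHopf m l I γ U f) →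
      BCV.IsSphereTimesLine m l ∨ BCV.IsHyperbolicPlaneTimesLine m l ∨ BCV.IsEuclidean m l) ∧
    ((BCV.IsSphere m l ∨ BCV.IsNil m l ∨ BCV.IsSLTilde m l ∨ BCV.IsSU m l) →
      ¬ ∃ (I : Set ℝ) (γ : ℝ → Fin 2 → ℝ) (U : Set (Fin 2 → ℝ)) (f : (Fin 2 → ℝ) → ℝ),
        BCV.IsProperBiharmonicHopf m l I γ U f) := by
  constructor
  · rintro ⟨I, γ, U, f, H⟩
    obtain rfl := H.eq_zero
    exact BCV.isSphereTimesLine_or_isHyperbolicPlaneTimesLine_or_isEuclidean m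
  · rintro (h | h | h | h) ⟨I, γ, U, f, H⟩
    all_goals exact h.1 H.eq_zero
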